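/- Let $n\ge 1$ and $\delta\in\mathbb R$. For Schwartz functions $f,g$ on $\mathbb R^n$ let $$S^\delta(f,g)(x)=\iint_{|\xi|^2+|\eta|^2\le 1}\bigl(1-|\xi|^2-|\eta|^2\bigr)^{\delta}\,\widehat f(\xi)\,\widehat g(\eta)\,e^{2\pi i x\cdot(\xi+\eta)}\,d\xi\,d\eta,\qquad x\in\mathbb R^n,$$ where $\widehat f(\xi)=\int_{\mathbb R^n}e^{-2\pi i x\cdot\xi}f(x)\,dx$. Let $p,q,r'\in[2,\infty)$ satisfy $\frac1p+\frac1q+\frac1{r'}=1$, and let $r$ be the conjugate exponent of $r'$, that is, $\frac1r+\frac1{r'}=1$ (equivalently $\frac1r=\frac1p+\frac1q$). If $\delta>\frac{n-1}{r'}$, then $S^\delta$ is bounded from $L^p(\mathbb R^n)\times L^q(\mathbb R^n)$ to $L^r(\mathbb R^n)$; that is, $S^\delta$ extends to a bilinear operator $L^p(\mathbb R^n)\times L^q(\mathbb R^n)\to L^r(\mathbb R^n)$ for which there is a constant $C$ with $$\|S^\delta(f,g)\|_{L^r}\le C\,\|f\|_{L^p}\|g\|_{L^q}\qquad\text{for all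 } f\in L^p(\mathbb R^n),\ g\in L^q(\mathbb R^n).$$ -/

import Mathlib

open MeasureTheory
open scoped ENNReal SchwartzMap FourierTransform

/-- The bilinear Bochner-Riesz operator `S^δ` on Schwartz functions on `ℝⁿ`:
`S^δ(f, g)(x) = ∬_{|ξ|² + |η|² ≤ 1} e^{2πi x·(ξ + η)} (1 - |ξ|² - |η|²)^δ f̂(ξ) ĝ(η) dξ dη`,
where `f̂(ξ) = ∫ e^{-2πi x·ξ} f(x) dx`. -/
noncomputable def bilinearBochnerRiesz (n : ℕ) (δ : ℝ)
    (f g : 𝓢(EuclideanSpace ℝ (Fin n), ℂ)) (x : EuclideanSpace ℝ (Fin n)) : ℂ :=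
  ∫ z in {z : EuclideanSpace ℝ (Fin n) × EuclideanSpace ℝ (Fin n) |
      ‖z.1‖ ^ 2 + ‖z.2‖ ^ 2 ≤ 1},
    Complex.exp (2 * (Real.pi : ℂ) * Complex.I * ((inner ℝ x (z.1 + z.2) : ℝ) : ℂ)) *
      (((1 - ‖z.1‖ ^ 2 - ‖z.2‖ ^ 2) ^ δ : ℝ) : ℂ) * (𝓕 f) z.1 * (𝓕 g) z.2

/-- An operator `T`, given on pairs of Schwartz functions, is bounded from
`L^p(ℝⁿ) × L^q(ℝⁿ)` to `L^r(ℝⁿ)`: it extends to a bilinear operator `B` on these spaces with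
`‖B(f, g)‖_r ≤ C ‖f‖_p ‖g‖_q`. -/
def IsBoundedBilinear {n : ℕ}
    (T : 𝓢(EuclideanSpace ℝ (Fin n), ℂ) → 𝓢(EuclideanSpace ℝ (Fin n), ℂ) →
      EuclideanSpace ℝ (Fin n) → ℂ) (p q r : ℝ≥0∞) : Prop :=
  ∃ B : Lp ℂ p (volume : Measure (EuclideanSpace ℝ (Fin n))) →ₗ[ℂ]
      Lp ℂ q (volume : Measure (EuclideanSpace ℝ (Fin n))) →ₗ[ℂ]
      Lp ℂ r (volume : Measure (EuclideanSpace ℝ (Fin n))),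
    (∃ C : ℝ, ∀ f g, ‖B f g‖ ≤ C * ‖f‖ * ‖g‖) ∧
    ∀ f g : 𝓢(EuclideanSpace ℝ (Fin n), ℂ),
      (B (f.toLp p volume) (g.toLp q volume) : EuclideanSpace ℝ (Fin n) → ℂ)
        =ᵐ[volume] T f g

/-! Fourier inversion of `v₊ ^ δ e ^ {-v}` writes `(1 - s)₊ ^ δ` as a superposition of exponentials
`exp (-b s)` over the line `Re b = 1`, with a density of size `‖b‖ ^ (-(δ + 1))`
(`integral_lineDensity_mul_exp`). At `s = ‖ξ‖² + ‖η‖²` each exponential splits into a product of two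
Gaussian multipliers, so `S^δ(f, g)` is the integral over the line of the density times a product of
complex heat evolutions of `f` and `g` (`bilinearBochnerRiesz_eq_lineBilin`).

The line is cut into blocks where `‖b‖` is about `N = 2 ^ j`. Cauchy-Schwarz in `t` on each block,
followed by Hölder in `x`, leaves one linear problem: the `L^p` norm of the square function
`squareFn j`. On `L²` the multipliers are contractions and the block has length `O(N)`, which costs
`N ^ (1/2)`. On `L^∞` the cost is `N ^ (d/2 + η)`, with `d` the dimension. Marcinkiewicz
interpolation gives `N ^ (d/2 - (d-1)/p + η)` (`exists_lintegral_squareFn_rpow_le`). Multiplying the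
bounds for `p` and `q` by `N ^ (-(δ + 1))` leaves `N ^ ((d-1)(1 - 1/r) - δ + 2η)`, which is summable
over `j` for small `η` exactly under the condition on `δ`.

The `L^∞` bound is the heart (`exists_squareFn_le`, `exists_lintegral_near_le`): the `L¹` norm of
the kernel alone would give `N ^ ((d+1)/2)`. The missing `N ^ (1/2)` comes from orthogonality in
`t`. Since `2 / b = 1 + z` with `z = b̄ / b` on the unit circle, `exp (-π² ‖y‖² / b)` is a power
series in `z` whose coefficients are, up to sign, Poisson probabilities in `‖y‖`. Bessel's
inequality on the circle, a weighted Cauchy-Schwarz inequality in `y`, and the fact that Poisson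
probabilities sum to one bound the part of `f` in a ball of radius `N ^ (1 + ε)`; Gaussian decay
handles the rest. -/

/-! ### Interpolation between `L²` and `L^∞`. -/

open Set in
lemma lintegral_Ioo_rpow_eq {s M : ℝ} (hs : -1 < s) (hM : 0 ≤ M) :
    ∫⁻ t in Ioo 0 M, ENNReal.ofReal (t ^ s) = ENNReal.ofReal (M ^ (s + 1) / (s + 1)) := by
  have hi : IntervalIntegrable (fun t : ℝ => t ^ s) volume 0 M :=
    intervalIntegral.intervalIntegrable_rpow' hs
  rw [Measure.restrict_congr_set Ioo_ae_eq_Ioc, ← ofReal_integral_eq_lintegral_ofReal]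
  · rw [← intervalIntegral.integral_of_le hM, integral_rpow (Or.inl hs),
      Real.zero_rpow (by linarith), sub_zero]
  · exact (intervalIntegrable_iff_integrableOn_Ioc_of_le hM).1 hi
  · filter_upwards [ae_restrict_mem measurableSet_Ioc] with t ht
    exact Real.rpow_nonneg ht.1.le _

open Set in
/-- Marcinkiewicz interpolation between a strong type `(2, 2)` and a strong type `(∞, ∞)` bound,
for a function `g` dominated by the image of the truncations of `f`. -/
theorem lintegral_rpow_le_of_truncation {α : Type*} [MeasurableSpace α] {μ : Measure α} [SFinite μ]
    {p B : ℝ} (hp : 2 < p) (hB : 0 < B) {A : ℝ≥0∞} (hA : A ≠ ⊤) {f : α → ℂ} (hf : Measurable f)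
    (hfp : ∫⁻ x, ‖f x‖ₑ ^ p ∂μ ≠ ⊤) {g : α → ℝ≥0∞} (hg : AEMeasurable g μ)
    (h : ∀ l : ℝ, 0 < l → ∃ u : α → ℝ≥0∞, AEMeasurable u μ ∧
      ∫⁻ x, u x ^ 2 ∂μ ≤ A * ∫⁻ x in {x | l < ‖f x‖}, ‖f x‖ₑ ^ 2 ∂μ ∧
      ∀ x, g x ≤ u x + ENNReal.ofReal (B * l)) :
    ∫⁻ x, g x ^ p ∂μ ≤
      ENNReal.ofReal (4 * p / (p - 2) * (2 * B) ^ (p - 2)) * A * ∫⁻ x, ‖f x‖ₑ ^ p ∂μ := by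
  have hlev : ∀ l : ℝ, MeasurableSet {x | l < ‖f x‖} := fun l =>
    measurableSet_lt measurable_const hf.norm
  -- The layer-cake formula is applied to `(g x).toReal`, so `g` must be finite almost everywhere;
  -- any single truncation level shows this.
  have hgfin : ∀ᵐ x ∂μ, g x < ⊤ := by
    obtain ⟨u, hu, hu2, hgu⟩ := h 1 one_pos
    have hfin : ∫⁻ x, u x ^ 2 ∂μ ≠ ⊤ := by
      refine ne_top_of_le_ne_top (ENNReal.mul_ne_top hA ?_) hu2
      refine ne_top_of_le_ne_top hfp ?_
      refine (lintegral_mono_ae ?_).trans (setLIntegral_le_lintegral {x | 1 < ‖f x‖} _)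
      filter_upwards [ae_restrict_mem (hlev 1)] with x hx
      have h1 : (1 : ℝ≥0∞) ≤ ‖f x‖ₑ := by
        rw [← ofReal_norm, ← ENNReal.ofReal_one]
        exact ENNReal.ofReal_le_ofReal (le_of_lt hx)
      rw [← ENNReal.rpow_two]
      exact ENNReal.rpow_le_rpow_of_exponent_le h1 hp.le
    filter_upwards [ae_lt_top' (hu.pow_const 2) hfin] with x hx
    refine lt_of_le_of_lt (hgu x) (ENNReal.add_lt_top.2 ⟨?_, ENNReal.ofReal_lt_top⟩)
    by_contra hcon
    rw [not_lt, top_le_iff] at hcon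
    simp [hcon] at hx
  have hweak : ∀ t : ℝ, 0 < t → μ {x | t < (g x).toReal} ≤
      ENNReal.ofReal (4 / t ^ 2) * A * ∫⁻ x in {x | t / (2 * B) < ‖f x‖}, ‖f x‖ₑ ^ 2 ∂μ := by
    intro t ht
    -- At this level the bounded part contributes at most `t / 2`, so `g > t` forces `u ≥ t / 2` and
    -- Chebyshev applies to `u`.
    obtain ⟨u, hu, hu2, hgu⟩ := h (t / (2 * B)) (by positivity)
    have hsub : {x | t < (g x).toReal} ⊆ {x | ENNReal.ofReal (t ^ 2 / 4) ≤ u x ^ 2} := by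
      intro x hx
      simp only [mem_ofPred_eq] at hx ⊢
      have h1 : ENNReal.ofReal t ≤ g x :=
        ENNReal.ofReal_le_of_le_toReal hx.le
      have h2 : ENNReal.ofReal (t / 2) + ENNReal.ofReal (t / 2) ≤
          u x + ENNReal.ofReal (t / 2) := by
        rw [← ENNReal.ofReal_add (by positivity) (by positivity), add_halves]
        convert! h1.trans (hgu x) using 3
        field_simp
      have h3 := (ENNReal.add_le_add_iff_right ENNReal.ofReal_ne_top).1 h2
      calc ENNReal.ofReal (t ^ 2 / 4) = ENNReal.ofReal (t / 2) ^ 2 := by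
            rw [← ENNReal.ofReal_pow (by positivity)]; congr 1; ring
        _ ≤ _ := pow_le_pow_left' h3 2
    calc μ {x | t < (g x).toReal} ≤ μ {x | ENNReal.ofReal (t ^ 2 / 4) ≤ u x ^ 2} :=
          measure_mono hsub
      _ ≤ (∫⁻ x, u x ^ 2 ∂μ) / ENNReal.ofReal (t ^ 2 / 4) :=
          meas_ge_le_lintegral_div (hu.pow_const 2)
            (by simp only [ne_eq, ENNReal.ofReal_eq_zero, not_le]; positivity) ENNReal.ofReal_ne_top
      _ = ENNReal.ofReal (4 / t ^ 2) * ∫⁻ x, u x ^ 2 ∂μ := by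
          rw [div_eq_mul_inv, ← ENNReal.ofReal_inv_of_pos (by positivity), mul_comm, inv_div]
      _ ≤ _ := by rw [mul_assoc]; gcongr
  calc ∫⁻ x, g x ^ p ∂μ = ∫⁻ x, ENNReal.ofReal ((g x).toReal ^ p) ∂μ := by
        refine lintegral_congr_ae ?_
        filter_upwards [hgfin] with x hx
        rw [← ENNReal.ofReal_rpow_of_nonneg ENNReal.toReal_nonneg (by linarith),
          ENNReal.ofReal_toReal hx.ne]
    _ = ENNReal.ofReal p * ∫⁻ t in Ioi 0, μ {x | t < (g x).toReal} *
          ENNReal.ofReal (t ^ (p - 1)) :=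
        lintegral_rpow_eq_lintegral_meas_lt_mul μ (Filter.Eventually.of_forall fun x =>
          ENNReal.toReal_nonneg) hg.ennreal_toReal (by linarith)
    _ ≤ ENNReal.ofReal p * ∫⁻ t in Ioi (0 : ℝ), (∫⁻ x, A * (ENNReal.ofReal (4 * t ^ (p - 3)) *
          {x | t / (2 * B) < ‖f x‖}.indicator (fun x => ‖f x‖ₑ ^ 2) x) ∂μ) := by
        refine mul_le_mul_right ?_ _
        refine setLIntegral_mono' measurableSet_Ioi fun t ht => ?_
        have ht : 0 < t := ht
        rw [lintegral_const_mul' _ _ hA, lintegral_const_mul' _ _ ENNReal.ofReal_ne_top,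
          lintegral_indicator (hlev _)]
        refine (mul_le_mul_left (hweak t ht) _).trans_eq ?_
        have : ENNReal.ofReal (4 * t ^ (p - 3)) =
            ENNReal.ofReal (4 / t ^ 2) * ENNReal.ofReal (t ^ (p - 1)) := by
          rw [← ENNReal.ofReal_mul (by positivity)]
          congr 1
          rw [show p - 3 = p - 1 - 2 by ring, Real.rpow_sub ht, Real.rpow_two]
          ring
        rw [this]
        ring
    _ = ENNReal.ofReal p * ∫⁻ x, (∫⁻ t in Ioi (0 : ℝ), A * (ENNReal.ofReal (4 * t ^ (p - 3)) *
          {x | t / (2 * B) < ‖f x‖}.indicator (fun x => ‖f x‖ₑ ^ 2) x)) ∂μ := by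
        congr 1
        refine lintegral_lintegral_swap ?_
        refine Measurable.aemeasurable ?_
        refine (Measurable.mul (by fun_prop) ?_).const_mul _
        simp only [indicator, mem_ofPred_eq]
        refine Measurable.ite ?_ (by fun_prop) (by fun_prop)
        exact measurableSet_lt (by fun_prop) (by fun_prop)
    _ ≤ ENNReal.ofReal p * ∫⁻ x, A * (ENNReal.ofReal (4 / (p - 2) * (2 * B) ^ (p - 2)) *
          ‖f x‖ₑ ^ p) ∂μ := by
        gcongr with x
        rw [lintegral_const_mul' _ _ hA]
        gcongr
        calc ∫⁻ t in Ioi 0, ENNReal.ofReal (4 * t ^ (p - 3)) *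
              {x | t / (2 * B) < ‖f x‖}.indicator (fun x => ‖f x‖ₑ ^ 2) x
            ≤ ∫⁻ t in Ioi 0, (Ioo 0 (2 * B * ‖f x‖)).indicator
              (fun t => ENNReal.ofReal (4 * t ^ (p - 3)) * ‖f x‖ₑ ^ 2) t := by
              refine setLIntegral_mono' measurableSet_Ioi fun t ht => ?_
              have ht : 0 < t := ht
              by_cases hx : t / (2 * B) < ‖f x‖
              · rw [indicator_of_mem (show x ∈ {x | t / (2 * B) < ‖f x‖} from hx),
                  indicator_of_mem]
                refine ⟨ht, ?_⟩
                rw [div_lt_iff₀ (by positivity)] at hx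
                linarith
              · rw [indicator_of_notMem (show x ∉ {x | t / (2 * B) < ‖f x‖} from hx)]
                simp
          _ ≤ ∫⁻ t in Ioo 0 (2 * B * ‖f x‖),
                ENNReal.ofReal (4 * t ^ (p - 3)) * ‖f x‖ₑ ^ 2 := by
              refine (setLIntegral_le_lintegral _ _).trans_eq ?_
              rw [lintegral_indicator measurableSet_Ioo]
          _ = ENNReal.ofReal 4 * (∫⁻ t in Ioo 0 (2 * B * ‖f x‖), ENNReal.ofReal (t ^ (p - 3))) *
                ‖f x‖ₑ ^ 2 := by
              rw [lintegral_mul_const' _ _ (by finiteness),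
                ← lintegral_const_mul' _ _ ENNReal.ofReal_ne_top]
              congr 2
              ext t
              rw [ENNReal.ofReal_mul (by norm_num)]
          _ = _ := by
              rw [lintegral_Ioo_rpow_eq (by linarith) (by positivity)]
              rw [← ofReal_norm, ← ENNReal.ofReal_pow (norm_nonneg _),
                ENNReal.ofReal_rpow_of_nonneg (norm_nonneg _) (by linarith),
                ← ENNReal.ofReal_mul (by norm_num), ← ENNReal.ofReal_mul, ← ENNReal.ofReal_mul]
              · congr 1
                rw [Real.mul_rpow (by positivity) (norm_nonneg _)]
                have : ‖f x‖ ^ p = ‖f x‖ ^ (p - 3 + 1) * ‖f x‖ ^ 2 := by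
                  rw [← Real.rpow_two, ← Real.rpow_add_of_nonneg (norm_nonneg _)
                    (by linarith) (by norm_num)]
                  congr 1
                  ring
                rw [this, show p - 3 + 1 = p - 2 by ring]
                ring
              · have : 0 < p - 2 := by linarith
                positivity
              · have : 0 < p - 3 + 1 := by linarith
                positivity
    _ = _ := by
        rw [lintegral_const_mul' _ _ hA, lintegral_const_mul' _ _ ENNReal.ofReal_ne_top,
          show 4 * p / (p - 2) * (2 * B) ^ (p - 2) = p * (4 / (p - 2) * (2 * B) ^ (p - 2)) by ring,
          ENNReal.ofReal_mul (p := p) (by linarith)]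
        ring

set_option linter.unusedSectionVars false

/-! ### Plancherel for the integral inverse Fourier transform. -/

section Plancherel

variable {V : Type*} [NormedAddCommGroup V] [InnerProductSpace ℝ V] [FiniteDimensional ℝ V]
  [MeasurableSpace V] [BorelSpace V]

/-- The integral inverse Fourier transform of a function in `L¹ ∩ L²` represents its `L²` inverse
Fourier transform. -/
theorem coeFn_fourierInv_toLp_ae_eq {φ : V → ℂ} (h1 : Integrable φ) (h2 : MemLp φ 2) :
    ((𝓕⁻ (h2.toLp φ) : Lp ℂ 2 (volume : Measure V)) : V → ℂ) =ᵐ[volume] 𝓕⁻ φ := by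
  set H : Lp ℂ 2 (volume : Measure V) := 𝓕⁻ (h2.toLp φ) with hH
  have hcont : Continuous (𝓕⁻ φ) := by
    have := VectorFourier.fourierIntegral_continuous Real.continuous_fourierChar
      (L := -innerₗ V) (by simpa using! continuous_inner.neg) h1
    exact this
  refine ae_eq_of_integral_contDiff_smul_eq ((Lp.memLp H).locallyIntegrable one_le_two)
    hcont.locallyIntegrable ?_
  intro g hg hgs
  set ψ : 𝓢(V, ℂ) := (hgs.comp_left (g := ((↑) : ℝ → ℂ)) rfl).toSchwartzMap
    (Complex.ofRealCLM.contDiff.comp hg) with hψ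
  have hψg : ∀ x, ψ x = (g x : ℂ) := fun x => rfl
  -- Both candidates are tested against `ψ`: the `L²` transform passes to `ψ` by the definition on
  -- tempered distributions, the integral one by the multiplication formula `key2`.
  have key : ∫ x, ψ x • H x = ∫ x, (𝓕⁻ ψ) x • φ x := by
    have e1 := Lp.toTemperedDistribution_apply (μ := volume) H ψ
    rw [← e1, hH, ← Lp.fourierInv_toTemperedDistribution_eq,
      TemperedDistribution.fourierInv_apply, Lp.toTemperedDistribution_apply]
    refine integral_congr_ae ?_
    filter_upwards [h2.coeFn_toLp] with x hx
    rw [hx]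
  have key2 : ∫ x, (𝓕⁻ ψ) x • φ x = ∫ x, ψ x • (𝓕⁻ φ) x := by
    have := VectorFourier.integral_fourierIntegral_smul_eq_flip (μ := (volume : Measure V))
      (ν := (volume : Measure V)) (L := -innerₗ V)
      Real.continuous_fourierChar (by simpa using! continuous_inner.neg) ψ.integrable h1
    have hflip : (-innerₗ V).flip = -innerₗ V := by
      ext x y
      simp [real_inner_comm]
    rw [hflip] at this
    have hinv : ∀ ξ, (𝓕⁻ ψ) ξ = VectorFourier.fourierIntegral Real.fourierChar volume
        (-innerₗ V) ψ ξ := fun ξ => by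
      rw [SchwartzMap.fourierInv_coe]
      rfl
    simp_rw [hinv]
    exact this
  have := key.trans key2
  simpa [hψg] using this

theorem eLpNorm_fourierInv_eq {φ : V → ℂ} (h1 : Integrable φ) (h2 : MemLp φ 2) :
    eLpNorm (𝓕⁻ φ) 2 = eLpNorm φ 2 := by
  rw [← eLpNorm_congr_ae (coeFn_fourierInv_toLp_ae_eq h1 h2)]
  have h3 : ‖(𝓕⁻ (h2.toLp φ) : Lp ℂ 2 (volume : Measure V))‖ = ‖h2.toLp φ‖ := by
    rw [← Lp.norm_fourier_eq, FourierTransform.fourier_fourierInv_eq]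
  have h4 := congrArg ENNReal.ofReal h3
  rw [ofReal_norm, ofReal_norm, Lp.enorm_def, Lp.enorm_def] at h4
  rw [h4, eLpNorm_congr_ae h2.coeFn_toLp]

end Plancherel

/-! ### Complex heat evolutions and their `L²` contractivity. -/

section GaussianKernel

variable {V : Type*} [NormedAddCommGroup V] [InnerProductSpace ℝ V] [FiniteDimensional ℝ V]
  [MeasurableSpace V] [BorelSpace V]

/-- The complex Gaussian with Fourier transform `exp (-b ‖ξ‖²)`. -/
noncomputable def gaussKer (b : ℂ) (y : V) : ℂ :=
  (Real.pi / b) ^ (Module.finrank ℝ V / 2 : ℂ) * Complex.exp (-Real.pi ^ 2 * ‖y‖ ^ 2 / b)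

/-- The Fourier multiplier operator with symbol `exp (-b ‖ξ‖²)`, as a convolution. -/
noncomputable def heatOp (b : ℂ) (f : V → ℂ) (x : V) : ℂ :=
  ∫ y, gaussKer b (x - y) * f y

lemma Complex.div_re_eq_of_re {b : ℂ} (a : ℝ) : ((a : ℂ) / b).re = a * (b.re / ‖b‖ ^ 2) := by
  rw [Complex.div_re, Complex.normSq_eq_norm_sq]
  simp
  ring

lemma norm_gaussKer (b : ℂ) (hb : b ≠ 0) (y : V) :
    ‖gaussKer b y‖ = (Real.pi / ‖b‖) ^ (Module.finrank ℝ V / 2 : ℝ) *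
      Real.exp (-(Real.pi ^ 2 * (b.re / ‖b‖ ^ 2)) * ‖y‖ ^ 2) := by
  unfold gaussKer
  have h1 : (Real.pi / b : ℂ) ≠ 0 := div_ne_zero (by exact_mod_cast Real.pi_ne_zero) hb
  rw [norm_mul, Complex.norm_exp,
    show (Module.finrank ℝ V / 2 : ℂ) = ((Module.finrank ℝ V / 2 : ℝ) : ℂ) by push_cast; rfl,
    Complex.norm_cpow_real, norm_div, Complex.norm_of_nonneg Real.pi_pos.le]
  congr 2
  rw [show (-Real.pi ^ 2 * ‖y‖ ^ 2 / b : ℂ) = ((-Real.pi ^ 2 * ‖y‖ ^ 2 : ℝ) : ℂ) / b by push_cast; rfl,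
    Complex.div_re_eq_of_re]
  ring

lemma continuous_gaussKer (b : ℂ) : Continuous (gaussKer b : V → ℂ) := by
  unfold gaussKer
  fun_prop

lemma integrable_exp_neg_mul_sq_norm {c : ℝ} (hc : 0 < c) :
    Integrable (fun y : V => Real.exp (-c * ‖y‖ ^ 2)) := by
  have := GaussianFourier.integrable_cexp_neg_mul_sq_norm_add (V := V) (b := c) (by simpa using hc) 0 0
  have h2 := this.norm
  refine h2.congr (Filter.Eventually.of_forall fun y => ?_)
  simp only [Complex.norm_exp]
  congr 1
  simp [← Complex.ofReal_pow]

lemma memLp_gaussKer {b : ℂ} (hb : 0 < b.re) (s : ℝ≥0∞) : MemLp (gaussKer b : V → ℂ) s := by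
  have hb0 : b ≠ 0 := by rintro rfl; simp at hb
  have hc : 0 < Real.pi ^ 2 * (b.re / ‖b‖ ^ 2) := by positivity
  by_cases hs0 : s = 0
  · rw [hs0, memLp_zero_iff_aestronglyMeasurable]
    exact (continuous_gaussKer b).aestronglyMeasurable
  by_cases hs : s = ⊤
  · rw [hs]
    refine memLp_top_of_bound (continuous_gaussKer b).aestronglyMeasurable
      ((Real.pi / ‖b‖) ^ (Module.finrank ℝ V / 2 : ℝ)) (Filter.Eventually.of_forall fun y => ?_)
    rw [norm_gaussKer b hb0]
    refine mul_le_of_le_one_right (by positivity) (Real.exp_le_one_iff.2 ?_)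
    have : 0 ≤ Real.pi ^ 2 * (b.re / ‖b‖ ^ 2) * ‖y‖ ^ 2 := by positivity
    linarith
  rw [← integrable_norm_rpow_iff (continuous_gaussKer b).aestronglyMeasurable hs0 hs]
  have hs' : 0 < s.toReal := ENNReal.toReal_pos hs0 hs
  refine ((integrable_exp_neg_mul_sq_norm (V := V) (mul_pos hc hs')).const_mul
    (((Real.pi / ‖b‖) ^ (Module.finrank ℝ V / 2 : ℝ)) ^ s.toReal)).congr
    (Filter.Eventually.of_forall fun y => ?_)
  simp only [norm_gaussKer b hb0]
  rw [Real.mul_rpow (by positivity) (by positivity), ← Real.exp_mul]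
  congr 2
  ring

lemma memLp_gaussKer_sub {b : ℂ} (hb : 0 < b.re) (s : ℝ≥0∞) (x : V) :
    MemLp (fun y : V => gaussKer b (x - y)) s :=
  (memLp_gaussKer hb s).comp_measurePreserving (Measure.measurePreserving_sub_left volume x)

lemma integrable_gaussKer_mul {b : ℂ} (hb : 0 < b.re) {p : ℝ≥0∞} (hp : 1 ≤ p) {f : V → ℂ}
    (hf : MemLp f p) (x : V) : Integrable (fun y : V => gaussKer b (x - y) * f y) := by
  have : ENNReal.HolderConjugate p.conjExponent p := by
    have := ENNReal.HolderConjugate.conjExponent hp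
    exact this.symm
  exact (memLp_gaussKer_sub hb p.conjExponent x).integrable_mul hf

lemma heatOp_add {b : ℂ} (hb : 0 < b.re) {p q : ℝ≥0∞} (hp : 1 ≤ p) (hq : 1 ≤ q) {f g : V → ℂ}
    (hf : MemLp f p) (hg : MemLp g q) (x : V) :
    heatOp b (f + g) x = heatOp b f x + heatOp b g x := by
  unfold heatOp
  rw [← integral_add (integrable_gaussKer_mul hb hp hf x) (integrable_gaussKer_mul hb hq hg x)]
  simp [mul_add]

lemma heatOp_smul (b c : ℂ) (f : V → ℂ) (x : V) : heatOp b (c • f) x = c * heatOp b f x := by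
  unfold heatOp
  rw [← integral_const_mul]
  congr 1 with y
  simp
  ring

lemma heatOp_congr_ae (b : ℂ) {f g : V → ℂ} (h : f =ᵐ[volume] g) (x : V) :
    heatOp b f x = heatOp b g x := by
  refine integral_congr_ae ?_
  filter_upwards [h] with y hy
  rw [hy]

lemma measurable_gaussKer_comp {α : Type*} [MeasurableSpace α] {c : α → ℂ} {x : α → V}
    (hc : Measurable c) (hx : Measurable x) : Measurable fun a => gaussKer (c a) (x a) := by
  unfold gaussKer
  fun_prop

lemma measurable_heatOp {α : Type*} [MeasurableSpace α] {c : α → ℂ} {x : α → V} {f : V → ℂ}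
    (hc : Measurable c) (hx : Measurable x) (hf : Measurable f) :
    Measurable fun a => heatOp (c a) f (x a) := by
  have h1 : Measurable fun q : α × V => gaussKer (c q.1) (x q.1 - q.2) :=
    measurable_gaussKer_comp (hc.comp measurable_fst) ((hx.comp measurable_fst).sub measurable_snd)
  have h2 : Measurable fun q : α × V => gaussKer (c q.1) (x q.1 - q.2) * f q.2 :=
    h1.mul (hf.comp measurable_snd)
  exact (h2.stronglyMeasurable.integral_prod_right' (ν := volume)).measurable

/-- The Gaussian multiplier `exp (-b ‖ξ‖²)`. -/
noncomputable def gaussMul (b : ℂ) (ξ : V) : ℂ := Complex.exp (-b * ‖ξ‖ ^ 2)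

lemma norm_gaussMul (b : ℂ) (ξ : V) : ‖gaussMul b ξ‖ = Real.exp (-b.re * ‖ξ‖ ^ 2) := by
  rw [gaussMul, Complex.norm_exp]
  congr 1
  simp [← Complex.ofReal_pow]

lemma norm_gaussMul_le_one {b : ℂ} (hb : 0 < b.re) (ξ : V) : ‖gaussMul b ξ‖ ≤ 1 := by
  rw [norm_gaussMul, Real.exp_le_one_iff]
  have : 0 ≤ b.re * ‖ξ‖ ^ 2 := by positivity
  linarith

lemma continuous_gaussMul (b : ℂ) : Continuous (gaussMul b : V → ℂ) := by
  unfold gaussMul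
  fun_prop

/-- The translated kernel is the Fourier transform of a modulated Gaussian, so the multiplication
formula moves the transform onto `f`. -/
lemma heatOp_schwartz_eq {b : ℂ} (hb : 0 < b.re) (f : 𝓢(V, ℂ)) (x : V) :
    heatOp b f x = 𝓕⁻ (fun ξ => gaussMul b ξ * 𝓕 f ξ) x := by
  have hflip := VectorFourier.integral_fourierIntegral_smul_eq_flip (μ := (volume : Measure V))
      (ν := (volume : Measure V)) (L := innerₗ V)
      Real.continuous_fourierChar (by simpa using! continuous_inner)
      (f := fun v : V => Complex.exp (-b * ‖v‖ ^ 2 + 2 * Real.pi * Complex.I * inner ℝ x v))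
      (by
        have := GaussianFourier.integrable_cexp_neg_mul_sq_norm_add (V := V) hb
          (2 * Real.pi * Complex.I) x
        exact this) f.integrable
  rw [flip_innerₗ] at hflip
  have e1 : ∀ y, VectorFourier.fourierIntegral Real.fourierChar volume (innerₗ V)
      (fun v : V => Complex.exp (-b * ‖v‖ ^ 2 + 2 * Real.pi * Complex.I * inner ℝ x v)) y =
      gaussKer b (x - y) := fun y =>
    fourier_gaussian_innerProductSpace' hb x y
  simp_rw [e1] at hflip
  rw [Real.fourierInv_eq']
  refine hflip.trans (integral_congr_ae (Filter.Eventually.of_forall fun ξ => ?_))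
  have : VectorFourier.fourierIntegral Real.fourierChar volume (innerₗ V) f ξ = 𝓕 f ξ := rfl
  simp only [this, smul_eq_mul, gaussMul]
  rw [Complex.exp_add, real_inner_comm]
  push_cast
  ring_nf

lemma eLpNorm_heatOp_schwartz_le {b : ℂ} (hb : 0 < b.re) (f : 𝓢(V, ℂ)) :
    eLpNorm (heatOp b f) 2 ≤ eLpNorm f 2 := by
  have h1 : heatOp b f = 𝓕⁻ (fun ξ => gaussMul b ξ * 𝓕 f ξ) := funext (heatOp_schwartz_eq hb f)
  have hle : ∀ ξ, ‖gaussMul b ξ * 𝓕 f ξ‖ ≤ ‖𝓕 f ξ‖ := fun ξ => by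
    rw [norm_mul]
    exact mul_le_of_le_one_left (norm_nonneg _) (norm_gaussMul_le_one hb ξ)
  have hm : AEStronglyMeasurable (fun ξ => gaussMul b ξ * 𝓕 f ξ) volume :=
    ((continuous_gaussMul b).mul (𝓕 f).continuous).aestronglyMeasurable
  rw [h1, eLpNorm_fourierInv_eq ((𝓕 f).integrable.mono hm (Filter.Eventually.of_forall hle))
    (((𝓕 f).memLp 2).mono hm (Filter.Eventually.of_forall hle))]
  refine (eLpNorm_mono hle).trans_eq ?_
  have h3 : ‖(𝓕 f).toLp 2 (volume : Measure V)‖ = ‖f.toLp 2 (volume : Measure V)‖ :=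
    f.norm_fourier_toL2_eq
  have h4 := congrArg ENNReal.ofReal h3
  rw [ofReal_norm, ofReal_norm, Lp.enorm_def, Lp.enorm_def] at h4
  rwa [eLpNorm_congr_ae ((𝓕 f).coeFn_toLp 2 _), eLpNorm_congr_ae (f.coeFn_toLp 2 _)] at h4

/-- Density of Schwartz functions together with Fatou's lemma: `L²` approximation makes the
evolutions converge at every point. -/
theorem eLpNorm_heatOp_le {b : ℂ} (hb : 0 < b.re) {f : V → ℂ} (hf : MemLp f 2) :
    eLpNorm (heatOp b f) 2 ≤ eLpNorm f 2 := by
  obtain ⟨u, hu⟩ : ∃ u : ℕ → 𝓢(V, ℂ), Filter.Tendsto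
      (fun k => (u k).toLp 2 (volume : Measure V)) Filter.atTop (nhds (hf.toLp f)) := by
    have hd := SchwartzMap.denseRange_toLpCLM (E := V) (F := ℂ) (p := 2)
      (μ := (volume : Measure V)) ENNReal.ofNat_ne_top
    obtain ⟨w, hw, hlim⟩ := mem_closure_iff_seq_limit.1 (hd (hf.toLp f))
    choose u hu using hw
    exact ⟨u, by
      have : (fun k => (u k).toLp 2 (volume : Measure V)) = w := funext hu
      rwa [this]⟩
  have hlim : ∀ x, Filter.Tendsto (fun k => heatOp b (u k) x) Filter.atTop
      (nhds (heatOp b f x)) := by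
    intro x
    -- The conjugated kernel lies in `L²`, so evaluation of the evolution at `x` is an inner product
    -- and hence continuous on `L²`.
    set κ : Lp ℂ 2 (volume : Measure V) :=
      ((memLp_gaussKer_sub hb 2 x).star).toLp _ with hκ
    have hin : ∀ g : Lp ℂ 2 (volume : Measure V), inner ℂ κ g = heatOp b g x := by
      intro g
      rw [L2.inner_def]
      refine integral_congr_ae ?_
      filter_upwards [((memLp_gaussKer_sub hb 2 x).star).coeFn_toLp] with y hy
      rw [hκ, hy]
      simp [mul_comm]
    have h1 : ∀ k, heatOp b (u k) x = inner ℂ κ ((u k).toLp 2 (volume : Measure V)) := fun k => by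
      rw [hin]
      exact heatOp_congr_ae b ((u k).coeFn_toLp 2 volume).symm x
    have h2 : heatOp b f x = inner ℂ κ (hf.toLp f) := by
      rw [hin]
      exact heatOp_congr_ae b hf.coeFn_toLp.symm x
    simp_rw [h1]
    rw [h2]
    exact tendsto_const_nhds.inner hu
  have hmeas : ∀ k, AEStronglyMeasurable (heatOp b (u k)) volume := fun k =>
    (measurable_heatOp measurable_const measurable_id
      (u k).continuous.measurable).aestronglyMeasurable
  refine (Lp.eLpNorm_lim_le_liminf_eLpNorm hmeas (heatOp b f)
    (Filter.Eventually.of_forall hlim)).trans ?_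
  refine (Filter.liminf_le_liminf (Filter.Eventually.of_forall fun k =>
    eLpNorm_heatOp_schwartz_le hb (u k))).trans_eq ?_
  have h5 : Filter.Tendsto (fun k => eLpNorm (u k) 2 (volume : Measure V)) Filter.atTop
      (nhds (eLpNorm f 2)) := by
    have := (ENNReal.continuous_ofReal.tendsto _).comp hu.norm
    simp only [Function.comp_def, ofReal_norm, Lp.enorm_def] at this
    rw [eLpNorm_congr_ae hf.coeFn_toLp] at this
    refine this.congr fun k => eLpNorm_congr_ae ((u k).coeFn_toLp 2 _)
  exact h5.liminf_eq

end GaussianKernel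

/-! ### Orthogonality on the unit circle, parametrized by the line `Re b = 1`. -/

section Circle

open Filter Topology ComplexConjugate

/-- The parametrization `1 + 2πit` of the line `Re b = 1`. -/
noncomputable def vertLine (t : ℝ) : ℂ := 1 + 2 * Real.pi * t * Complex.I

/-- The parametrization `b̄ / b`, `b = 1 + 2πit`, of the unit circle. -/
noncomputable def cayley (t : ℝ) : ℂ := conj (vertLine t) / vertLine t

@[simp] lemma vertLine_re (t : ℝ) : (vertLine t).re = 1 := by simp [vertLine]

lemma vertLine_re_pos (t : ℝ) : 0 < (vertLine t).re := by simp

lemma vertLine_ne_zero (t : ℝ) : vertLine t ≠ 0 := fun h => by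
  have := vertLine_re t
  simp [h] at this

@[fun_prop] lemma continuous_vertLine : Continuous vertLine := by
  unfold vertLine
  fun_prop

@[fun_prop] lemma measurable_vertLine : Measurable vertLine := continuous_vertLine.measurable

lemma norm_vertLine_sq (t : ℝ) : ‖vertLine t‖ ^ 2 = 1 + (2 * Real.pi * t) ^ 2 := by
  rw [← Complex.normSq_eq_norm_sq, Complex.normSq_apply]
  simp [vertLine]
  ring

lemma one_le_norm_vertLine (t : ℝ) : 1 ≤ ‖vertLine t‖ := by
  have := Complex.re_le_norm (vertLine t)
  rwa [vertLine_re] at this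

lemma norm_vertLine_pos (t : ℝ) : 0 < ‖vertLine t‖ := one_pos.trans_le (one_le_norm_vertLine t)

lemma conj_vertLine (t : ℝ) : conj (vertLine t) = 2 - vertLine t := by
  simp only [vertLine, map_add, map_one, map_mul, Complex.conj_ofReal, Complex.conj_I, map_ofNat]
  ring

/-- This makes a Gaussian exponent in `1 / b` affine in the circle variable, which is what allows a
power series expansion. -/
lemma two_div_vertLine (t : ℝ) : 2 / vertLine t = 1 + cayley t := by
  rw [cayley, conj_vertLine]
  field_simp [vertLine_ne_zero t]
  ring

lemma norm_cayley (t : ℝ) : ‖cayley t‖ = 1 := by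
  rw [cayley, norm_div, RCLike.norm_conj, div_self (norm_vertLine_pos t).ne']

lemma cayley_ne_zero (t : ℝ) : cayley t ≠ 0 := fun h => by
  have := norm_cayley t
  simp [h] at this

@[fun_prop] lemma continuous_cayley : Continuous cayley := by
  unfold cayley
  exact (Complex.continuous_conj.comp continuous_vertLine).div continuous_vertLine vertLine_ne_zero

lemma hasDerivAt_cayley (t : ℝ) :
    HasDerivAt cayley (-(4 * Real.pi * Complex.I) / vertLine t ^ 2) t := by
  have h1 : HasDerivAt vertLine (2 * Real.pi * Complex.I) t := by
    have := (((hasDerivAt_id (t : ℂ)).const_mul (2 * Real.pi : ℂ)).mul_const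
      Complex.I).const_add 1
    exact this.comp_ofReal.congr_deriv (by simp)
  have h2 : cayley = fun t => 2 / vertLine t - 1 := by
    ext t
    rw [two_div_vertLine]
    ring
  rw [h2]
  have := ((hasDerivAt_const t (2 : ℂ)).div h1 (vertLine_ne_zero t)).sub_const 1
  refine this.congr_deriv ?_
  ring

lemma tendsto_cayley {l : Filter ℝ} (hl : Tendsto (fun t : ℝ => |t|) l atTop) :
    Tendsto cayley l (𝓝 (-1)) := by
  have h2 : cayley = fun t => 2 / vertLine t - 1 := by
    ext t
    rw [two_div_vertLine]
    ring
  have h3 : Tendsto (fun t => ‖vertLine t‖) l atTop := by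
    refine tendsto_atTop_mono (fun t => ?_) hl
    refine abs_le_of_sq_le_sq' ?_ (norm_nonneg _) |>.2
    rw [norm_vertLine_sq, sq_abs]
    nlinarith [Real.pi_gt_three, sq_nonneg t, mul_nonneg (sq_nonneg t) (sq_nonneg (Real.pi - 3)),
      mul_nonneg (sq_nonneg t) (sub_nonneg.2 Real.pi_gt_three.le)]
  have h4 : Tendsto (fun t => 2 / vertLine t) l (𝓝 0) := by
    rw [tendsto_zero_iff_norm_tendsto_zero]
    simp only [norm_div]
    exact h3.const_div_atTop _
  rw [h2]
  simpa using h4.sub_const 1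

lemma integrable_inv_norm_vertLine_sq : Integrable (fun t => 1 / ‖vertLine t‖ ^ 2) := by
  have := integrable_inv_one_add_sq.comp_mul_left' (R := 2 * Real.pi) (by positivity)
  refine this.congr (Eventually.of_forall fun t => ?_)
  simp [norm_vertLine_sq]

lemma integral_inv_norm_vertLine_sq : ∫ t, 1 / ‖vertLine t‖ ^ 2 = 1 / 2 := by
  have := Measure.integral_comp_mul_left (fun x : ℝ => (1 + x ^ 2)⁻¹) (2 * Real.pi)
  rw [integral_univ_inv_one_add_sq] at this
  simp only [norm_vertLine_sq, one_div]
  rw [this, abs_of_pos (by positivity), smul_eq_mul]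
  field_simp

lemma integrable_cayley_zpow_div (m : ℤ) :
    Integrable (fun t => cayley t ^ m * ((1 / ‖vertLine t‖ ^ 2 : ℝ) : ℂ)) := by
  refine integrable_inv_norm_vertLine_sq.ofReal.bdd_mul (c := 1) ?_ ?_
  · exact (continuous_cayley.zpow₀ m fun t => Or.inl (cayley_ne_zero t)).aestronglyMeasurable
  · exact Eventually.of_forall fun t => by simp [norm_cayley]

/-- With `z = b̄ / b` one has `z' / z = -4πi / ‖b‖²`, so the integrand is the derivative of a
multiple of `z ^ m`. Both ends of the line map to `z = -1`, so the boundary terms cancel. -/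
lemma integral_cayley_zpow_div {m : ℤ} (hm : m ≠ 0) :
    ∫ t, cayley t ^ m * ((1 / ‖vertLine t‖ ^ 2 : ℝ) : ℂ) = 0 := by
  set κ : ℂ := (m : ℂ) * (-(4 * Real.pi * Complex.I)) with hκ
  have hκ0 : κ ≠ 0 := by
    rw [hκ]
    have : (m : ℂ) ≠ 0 := by exact_mod_cast hm
    simp [this, Real.pi_ne_zero]
  have hd : ∀ t, HasDerivAt (fun t => κ⁻¹ * cayley t ^ m)
      (cayley t ^ m * ((1 / ‖vertLine t‖ ^ 2 : ℝ) : ℂ)) t := by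
    intro t
    have h1 := ((hasDerivAt_zpow m (cayley t) (Or.inl (cayley_ne_zero t))).comp t
      (hasDerivAt_cayley t)).const_mul κ⁻¹
    refine h1.congr_deriv ?_
    have h2 : ((‖vertLine t‖ ^ 2 : ℝ) : ℂ) = vertLine t * conj (vertLine t) := by
      rw [Complex.mul_conj, Complex.normSq_eq_norm_sq]
    have hb := vertLine_ne_zero t
    have hb' : conj (vertLine t) ≠ 0 := by simpa using hb
    rw [Complex.ofReal_div, h2, zpow_sub_one₀ (cayley_ne_zero t)]
    have h3 : (cayley t)⁻¹ = vertLine t / conj (vertLine t) := by rw [cayley, inv_div]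
    rw [h3, Complex.ofReal_one, hκ]
    have : (m : ℂ) ≠ 0 := by exact_mod_cast hm
    have hpi : (Real.pi : ℂ) ≠ 0 := by exact_mod_cast Real.pi_ne_zero
    field_simp
  have hlim : ∀ {l : Filter ℝ}, Tendsto (fun t : ℝ => |t|) l atTop →
      Tendsto (fun t => κ⁻¹ * cayley t ^ m) l (𝓝 (κ⁻¹ * (-1) ^ m)) := fun hl =>
    ((tendsto_cayley hl).zpow₀ m (Or.inl (by norm_num))).const_mul _
  rw [integral_of_hasDerivAt_of_tendsto hd (integrable_cayley_zpow_div m)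
    (hlim tendsto_abs_atBot_atTop) (hlim tendsto_abs_atTop_atTop), sub_self]

lemma integral_norm_sum_cayley_sq (N : ℕ) (c : ℕ → ℂ) :
    ∫ t, ‖∑ k ∈ Finset.range N, c k * cayley t ^ k‖ ^ 2 * (1 / ‖vertLine t‖ ^ 2) =
      1 / 2 * ∑ k ∈ Finset.range N, ‖c k‖ ^ 2 := by
  have hconj : ∀ t, conj (cayley t) = (cayley t)⁻¹ := fun t => by
    rw [Complex.inv_def, Complex.normSq_eq_norm_sq, norm_cayley]
    simp
  have hpt : ∀ t, ((‖∑ k ∈ Finset.range N, c k * cayley t ^ k‖ ^ 2 * (1 / ‖vertLine t‖ ^ 2) : ℝ)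
      : ℂ) = ∑ j ∈ Finset.range N, ∑ k ∈ Finset.range N, c j * conj (c k) *
        (cayley t ^ ((j : ℤ) - k) * ((1 / ‖vertLine t‖ ^ 2 : ℝ) : ℂ)) := by
    intro t
    rw [Complex.ofReal_mul, Complex.ofReal_pow, ← Complex.mul_conj', map_sum, Finset.sum_mul_sum,
      Finset.sum_mul]
    refine Finset.sum_congr rfl fun j _ => ?_
    rw [Finset.sum_mul]
    refine Finset.sum_congr rfl fun k _ => ?_
    rw [map_mul, map_pow, hconj, zpow_sub₀ (cayley_ne_zero t), zpow_natCast, zpow_natCast,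
      inv_pow]
    ring
  rw [← Complex.ofReal_inj, ← integral_complex_ofReal]
  simp_rw [hpt]
  rw [integral_finsetSum _ fun j _ => integrable_finsetSum _ fun k _ =>
    (integrable_cayley_zpow_div _).const_mul _]
  have hin : ∀ j ∈ Finset.range N, ∫ t, ∑ k ∈ Finset.range N, c j * conj (c k) *
      (cayley t ^ ((j : ℤ) - k) * ((1 / ‖vertLine t‖ ^ 2 : ℝ) : ℂ)) = 1 / 2 * (‖c j‖ : ℂ) ^ 2 := by
    intro j hj
    rw [integral_finsetSum _ fun k _ => (integrable_cayley_zpow_div _).const_mul _,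
      Finset.sum_eq_single j]
    · rw [integral_const_mul, sub_self]
      simp only [zpow_zero, one_mul]
      rw [integral_complex_ofReal, integral_inv_norm_vertLine_sq, Complex.mul_conj']
      push_cast
      ring
    · intro k _ hk
      rw [integral_const_mul, integral_cayley_zpow_div, mul_zero]
      rw [sub_ne_zero]
      exact_mod_cast hk.symm
    · exact fun h => absurd hj h
  rw [Finset.sum_congr rfl hin, ← Finset.mul_sum]
  push_cast
  rfl

/-- Bessel's inequality for power series on the unit circle, parametrized by the line
`Re b = 1`. -/
theorem lintegral_enorm_sq_le_tsum {c : ℕ → ℂ} {H : ℝ → ℂ}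
    (h : ∀ t, HasSum (fun k => c k * cayley t ^ k) (H t)) :
    ∫⁻ t, ‖H t‖ₑ ^ 2 * ENNReal.ofReal (1 / ‖vertLine t‖ ^ 2) ≤ ∑' k, ‖c k‖ₑ ^ 2 := by
  have hlim : ∀ t, Tendsto (fun N => ‖∑ k ∈ Finset.range N, c k * cayley t ^ k‖ₑ ^ 2 *
      ENNReal.ofReal (1 / ‖vertLine t‖ ^ 2)) atTop
      (𝓝 (‖H t‖ₑ ^ 2 * ENNReal.ofReal (1 / ‖vertLine t‖ ^ 2))) := by
    intro t
    refine ENNReal.Tendsto.mul_const ?_ (Or.inr ENNReal.ofReal_ne_top)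
    exact ((ENNReal.continuous_pow 2).comp continuous_enorm).continuousAt.tendsto.comp
      (h t).tendsto_sum_nat
  have hbound : ∀ N, ∫⁻ t, ‖∑ k ∈ Finset.range N, c k * cayley t ^ k‖ₑ ^ 2 *
      ENNReal.ofReal (1 / ‖vertLine t‖ ^ 2) ≤ ∑' k, ‖c k‖ₑ ^ 2 := by
    intro N
    have hcont : Continuous fun t => ∑ k ∈ Finset.range N, c k * cayley t ^ k := by fun_prop
    have hint : Integrable fun t => ‖∑ k ∈ Finset.range N, c k * cayley t ^ k‖ ^ 2 *
        (1 / ‖vertLine t‖ ^ 2) := by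
      refine integrable_inv_norm_vertLine_sq.bdd_mul (c := (∑ k ∈ Finset.range N, ‖c k‖) ^ 2)
        (hcont.norm.pow 2).aestronglyMeasurable (Eventually.of_forall fun t => ?_)
      rw [norm_pow, norm_norm]
      refine pow_le_pow_left₀ (norm_nonneg _) ((norm_sum_le _ _).trans_eq ?_) 2
      simp [norm_cayley]
    calc ∫⁻ t, ‖∑ k ∈ Finset.range N, c k * cayley t ^ k‖ₑ ^ 2 *
          ENNReal.ofReal (1 / ‖vertLine t‖ ^ 2)
        = ∫⁻ t, ENNReal.ofReal (‖∑ k ∈ Finset.range N, c k * cayley t ^ k‖ ^ 2 *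
          (1 / ‖vertLine t‖ ^ 2)) := by
          refine lintegral_congr fun t => ?_
          rw [ENNReal.ofReal_mul (by positivity), ENNReal.ofReal_pow (norm_nonneg _), ofReal_norm]
      _ = ENNReal.ofReal (1 / 2 * ∑ k ∈ Finset.range N, ‖c k‖ ^ 2) := by
          rw [← integral_norm_sum_cayley_sq, ofReal_integral_eq_lintegral_ofReal hint
            (Eventually.of_forall fun t => by positivity)]
      _ ≤ ENNReal.ofReal (∑ k ∈ Finset.range N, ‖c k‖ ^ 2) := by
          refine ENNReal.ofReal_le_ofReal ?_
          have : 0 ≤ ∑ k ∈ Finset.range N, ‖c k‖ ^ 2 := by positivity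
          linarith
      _ = ∑ k ∈ Finset.range N, ‖c k‖ₑ ^ 2 := by
          rw [ENNReal.ofReal_sum_of_nonneg fun _ _ => by positivity]
          refine Finset.sum_congr rfl fun k _ => ?_
          rw [ENNReal.ofReal_pow (norm_nonneg _), ofReal_norm]
      _ ≤ _ := ENNReal.sum_le_tsum _
  -- Fatou's lemma passes from partial sums to the limit using only pointwise convergence.
  calc ∫⁻ t, ‖H t‖ₑ ^ 2 * ENNReal.ofReal (1 / ‖vertLine t‖ ^ 2)
      = ∫⁻ t, liminf (fun N => ‖∑ k ∈ Finset.range N, c k * cayley t ^ k‖ₑ ^ 2 *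
          ENNReal.ofReal (1 / ‖vertLine t‖ ^ 2)) atTop :=
        lintegral_congr fun t => (hlim t).liminf_eq.symm
    _ ≤ liminf (fun N => ∫⁻ t, ‖∑ k ∈ Finset.range N, c k * cayley t ^ k‖ₑ ^ 2 *
          ENNReal.ofReal (1 / ‖vertLine t‖ ^ 2)) atTop := by
        refine lintegral_liminf_le fun N => ?_
        have hcont : Continuous fun t => ∑ k ∈ Finset.range N, c k * cayley t ^ k := by fun_prop
        exact (hcont.measurable.enorm.pow_const 2).mul
          (by fun_prop : Measurable fun t => ENNReal.ofReal (1 / ‖vertLine t‖ ^ 2))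
    _ ≤ _ := liminf_le_of_frequently_le' (Frequently.of_forall hbound)

end Circle

/-! ### Poisson weights and radial integrals. -/

section Poisson

open Filter Topology Set

/-- The probability that a Poisson variable with mean `π² r² / 2` equals `k`. -/
noncomputable def poissonWeight (k : ℕ) (r : ℝ) : ℝ :=
  Real.exp (-(Real.pi ^ 2 * r ^ 2 / 2)) * (Real.pi ^ 2 * r ^ 2 / 2) ^ k / k.factorial

lemma poissonWeight_nonneg (k : ℕ) (r : ℝ) : 0 ≤ poissonWeight k r := by
  unfold poissonWeight
  positivity

@[fun_prop] lemma continuous_poissonWeight (k : ℕ) : Continuous (poissonWeight k) := by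
  unfold poissonWeight
  fun_prop

@[fun_prop] lemma measurable_poissonWeight (k : ℕ) : Measurable (poissonWeight k) :=
  (continuous_poissonWeight k).measurable

lemma hasSum_poissonWeight (r : ℝ) : HasSum (fun k => poissonWeight k r) 1 := by
  have h := (NormedSpace.expSeries_div_hasSum_exp (Real.pi ^ 2 * r ^ 2 / 2)).mul_left
    (Real.exp (-(Real.pi ^ 2 * r ^ 2 / 2)))
  rw [← Real.exp_eq_exp_ℝ, ← Real.exp_add, neg_add_cancel, Real.exp_zero] at h
  refine h.congr_fun fun k => ?_
  rw [poissonWeight, mul_div_assoc]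

lemma poissonWeight_le_one (k : ℕ) (r : ℝ) : poissonWeight k r ≤ 1 :=
  le_hasSum (hasSum_poissonWeight r) k fun j _ => poissonWeight_nonneg j r

lemma mul_poissonWeight_eq (r : ℝ) (k : ℕ) :
    r * poissonWeight k r = ((Real.pi ^ 2 / 2) ^ k / k.factorial) *
      (r ^ (2 * k + 1 : ℝ) * Real.exp (-(Real.pi ^ 2 / 2) * r ^ (2 : ℝ))) := by
  have : r ^ (2 * k + 1 : ℝ) = r ^ (2 * k + 1) := by
    rw [← Real.rpow_natCast]
    push_cast
    rfl
  rw [this, Real.rpow_two, poissonWeight, pow_succ r (2 * k), pow_mul r,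
    show Real.pi ^ 2 * r ^ 2 / 2 = Real.pi ^ 2 / 2 * r ^ 2 by ring, mul_pow, neg_mul]
  ring

lemma integrableOn_mul_poissonWeight (k : ℕ) :
    IntegrableOn (fun r => r * poissonWeight k r) (Ioi 0) := by
  have h := (integrableOn_rpow_mul_exp_neg_mul_rpow (s := 2 * k + 1) (p := 2)
    (b := Real.pi ^ 2 / 2) (by have : (0 : ℝ) ≤ k := by positivity
                               linarith) (by norm_num) (by positivity)).const_mul
    ((Real.pi ^ 2 / 2) ^ k / k.factorial)
  exact IntegrableOn.congr_fun h (fun r _ => (mul_poissonWeight_eq r k).symm) measurableSet_Ioi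

/-- Substituting `u = π² r² / 2` turns this into a Gamma integral divided by `k!`. The point is that
the value does not depend on `k`. -/
lemma integral_mul_poissonWeight (k : ℕ) :
    ∫ r in Ioi (0 : ℝ), r * poissonWeight k r = 1 / Real.pi ^ 2 := by
  rw [setIntegral_congr_fun measurableSet_Ioi fun r _ => mul_poissonWeight_eq r k,
    integral_const_mul, integral_rpow_mul_exp_neg_mul_rpow (by norm_num)
      (by have : (0 : ℝ) ≤ k := by positivity
          linarith) (by positivity)]
  have h1 : ((2 * k + 1 + 1 : ℝ)) / 2 = k + 1 := by ring
  rw [h1, neg_div, h1, Real.Gamma_nat_eq_factorial, Real.rpow_neg (by positivity),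
    Real.rpow_add_one (by positivity), Real.rpow_natCast]
  have : (k.factorial : ℝ) ≠ 0 := by positivity
  field_simp

variable {V : Type*} [NormedAddCommGroup V] [InnerProductSpace ℝ V] [FiniteDimensional ℝ V]
  [MeasurableSpace V] [BorelSpace V]

/-- Polar coordinates; the Jacobian `r ^ (d - 1)` is absorbed in the majorant. -/
lemma lintegral_norm_le_of_le [Nontrivial V] {F G : ℝ → ℝ} (hF : Measurable F)
    (hF0 : ∀ r, 0 ≤ F r)
    (hG : IntegrableOn G (Ioi 0)) (h : ∀ r, 0 < r → r ^ (Module.finrank ℝ V - 1) * F r ≤ G r) :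
    ∫⁻ y : V, ENNReal.ofReal (F ‖y‖) ≤ ENNReal.ofReal
      (Module.finrank ℝ V * (volume : Measure V).real (Metric.ball 0 1) *
        ∫ r in Ioi (0 : ℝ), G r) := by
  have hI : IntegrableOn (fun r : ℝ => r ^ (Module.finrank ℝ V - 1) • F r) (Ioi 0) := by
    refine Integrable.mono' hG (Measurable.aestronglyMeasurable (by fun_prop)) ?_
    filter_upwards [ae_restrict_mem measurableSet_Ioi] with r (hr : 0 < r)
    rw [smul_eq_mul, Real.norm_of_nonneg (mul_nonneg (by positivity) (hF0 r))]
    exact h r hr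
  have hI' : Integrable (fun y : V => F ‖y‖) :=
    (integrable_fun_norm_addHaar (volume : Measure V)).2 hI
  rw [← ofReal_integral_eq_lintegral_ofReal hI' (Eventually.of_forall fun y => hF0 _),
    integral_fun_norm_addHaar]
  refine ENNReal.ofReal_le_ofReal ?_
  rw [nsmul_eq_mul, smul_eq_mul, ← mul_assoc]
  refine mul_le_mul_of_nonneg_left ?_ (by positivity)
  exact setIntegral_mono_on hI hG measurableSet_Ioi fun r hr => h r hr

/-- A polynomial weight that balances the radial mass of `poissonWeight` in the space `V`. -/
noncomputable def balanceWeight (d : ℕ) (ε r : ℝ) : ℝ := (1 + |r|) ^ ((d : ℝ) - 2 + ε)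

lemma balanceWeight_pos (d : ℕ) (ε r : ℝ) : 0 < balanceWeight d ε r := by
  unfold balanceWeight
  positivity

@[fun_prop] lemma measurable_balanceWeight (d : ℕ) (ε : ℝ) : Measurable (balanceWeight d ε) := by
  unfold balanceWeight
  fun_prop

lemma pow_mul_inv_balanceWeight_le {d : ℕ} (hd : 1 ≤ d) {ε r : ℝ} (hε : 0 ≤ ε) (hr : 0 < r) :
    r ^ (d - 1) * (balanceWeight d ε r)⁻¹ ≤ 1 + r := by
  have h1 : r ^ (d - 1) ≤ (1 + r) ^ ((d : ℝ) - 1) := by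
    have : (1 + r) ^ ((d : ℝ) - 1) = (1 + r) ^ (d - 1) := by
      rw [← Real.rpow_natCast, Nat.cast_sub hd, Nat.cast_one]
    rw [this]
    gcongr
    linarith
  rw [balanceWeight, abs_of_pos hr, ← Real.rpow_neg (by positivity)]
  calc r ^ (d - 1) * (1 + r) ^ (-((d : ℝ) - 2 + ε))
      ≤ (1 + r) ^ ((d : ℝ) - 1) * (1 + r) ^ (-((d : ℝ) - 2 + ε)) := by gcongr
    _ = (1 + r) ^ (1 - ε) := by
        rw [← Real.rpow_add (by positivity)]
        congr 1
        ring
    _ ≤ (1 + r) ^ (1 : ℝ) := Real.rpow_le_rpow_of_exponent_le (by linarith) (by linarith)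
    _ = _ := Real.rpow_one _

-- The weight reduces the radial density to at most `(1 + r)` times the Poisson weight. Below radius
-- one this is at most `2`; beyond it, at most twice the integrand of `integral_mul_poissonWeight`.
-- Hence the bound is uniform in `k`.
variable (V) in
lemma exists_lintegral_poissonWeight_le [Nontrivial V] {ε : ℝ} (hε : 0 ≤ ε) : ∃ D : ℝ, 0 ≤ D ∧ ∀ k,
    ∫⁻ y : V, ENNReal.ofReal (poissonWeight k ‖y‖ *
      (balanceWeight (Module.finrank ℝ V) ε ‖y‖)⁻¹) ≤ ENNReal.ofReal D := by
  refine ⟨Module.finrank ℝ V * (volume : Measure V).real (Metric.ball 0 1) *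
    (2 + 2 * (1 / Real.pi ^ 2)), by positivity, fun k => ?_⟩
  have hi1 : IntegrableOn (fun r : ℝ => (Ioo (0 : ℝ) 1).indicator (fun _ => (2 : ℝ)) r) (Ioi 0) := by
    refine Integrable.integrableOn ?_
    rw [integrable_indicator_iff measurableSet_Ioo]
    exact integrableOn_const (by simp)
  have hi2 := (integrableOn_mul_poissonWeight k).const_mul 2
  refine (lintegral_norm_le_of_le (F := fun r => poissonWeight k r *
    (balanceWeight (Module.finrank ℝ V) ε r)⁻¹) (by fun_prop) (fun r =>
      mul_nonneg (poissonWeight_nonneg k r) (inv_nonneg.2 (balanceWeight_pos _ _ _).le))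
      (G := fun r => (Ioo (0 : ℝ) 1).indicator (fun _ => (2 : ℝ)) r + 2 * (r * poissonWeight k r))
      (hi1.add hi2) ?_).trans_eq ?_
  · intro r hr
    have h1 := pow_mul_inv_balanceWeight_le (d := Module.finrank ℝ V)
      Module.finrank_pos hε hr
    have h2 := poissonWeight_le_one k r
    have h3 := poissonWeight_nonneg k r
    have h4 : r ^ (Module.finrank ℝ V - 1) * (poissonWeight k r *
        (balanceWeight (Module.finrank ℝ V) ε r)⁻¹) ≤ (1 + r) * poissonWeight k r := by
      rw [mul_left_comm, mul_comm]
      gcongr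
    refine h4.trans ?_
    by_cases hr1 : r < 1
    · rw [indicator_of_mem (show r ∈ Ioo (0 : ℝ) 1 from ⟨hr, hr1⟩)]
      nlinarith
    · rw [indicator_of_notMem fun h => hr1 h.2]
      nlinarith
  · congr 2
    rw [integral_add hi1 hi2, integral_const_mul, integral_mul_poissonWeight,
      setIntegral_indicator measurableSet_Ioo, inter_eq_right.2 Ioo_subset_Ioi_self]
    simp

-- In polar coordinates the integrand is at most `(1 + r) ^ (2d - 3 + ε)`. Strict positivity of `ε`
-- keeps the integrated exponent `2d - 2 + ε` positive even when `d = 1`.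
variable (V) in
lemma exists_lintegral_balanceWeight_le [Nontrivial V] {ε : ℝ} (hε : 0 < ε) :
    ∃ D : ℝ, 0 ≤ D ∧ ∀ R : ℝ, 0 ≤ R →
      ∫⁻ y in Metric.ball (0 : V) R, ENNReal.ofReal (balanceWeight (Module.finrank ℝ V) ε ‖y‖) ≤
        ENNReal.ofReal (D * (1 + R) ^ (2 * (Module.finrank ℝ V : ℝ) - 2 + ε)) := by
  set d := Module.finrank ℝ V with hd
  have hd1 : 1 ≤ d := Module.finrank_pos
  have hd1' : (1 : ℝ) ≤ d := by exact_mod_cast hd1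
  have hs : 0 < 2 * (d : ℝ) - 2 + ε := by linarith
  refine ⟨d * (volume : Measure V).real (Metric.ball 0 1) * (2 * (d : ℝ) - 2 + ε)⁻¹,
    by positivity, fun R hR => ?_⟩
  have hcont : ContinuousOn (fun r : ℝ => (1 + r) ^ (2 * (d : ℝ) - 3 + ε)) (Icc 0 R) := by
    refine ContinuousOn.rpow_const (by fun_prop) fun r hr => Or.inl ?_
    have := hr.1
    linarith
  have hi0 : IntegrableOn (fun r : ℝ => (1 + r) ^ (2 * (d : ℝ) - 3 + ε)) (Ioo 0 R) :=
    hcont.integrableOn_Icc.mono_set Ioo_subset_Icc_self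
  have hi : IntegrableOn ((Ioo (0 : ℝ) R).indicator fun r => (1 + r) ^ (2 * (d : ℝ) - 3 + ε))
      (Ioi 0) := by
    refine Integrable.integrableOn ?_
    rwa [integrable_indicator_iff measurableSet_Ioo]
  have hval : ∫ r in Ioi (0 : ℝ), (Ioo (0 : ℝ) R).indicator
      (fun r => (1 + r) ^ (2 * (d : ℝ) - 3 + ε)) r ≤
      (2 * (d : ℝ) - 2 + ε)⁻¹ * (1 + R) ^ (2 * (d : ℝ) - 2 + ε) := by
    rw [setIntegral_indicator measurableSet_Ioo, inter_eq_right.2 Ioo_subset_Ioi_self,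
      ← integral_Ioc_eq_integral_Ioo, ← intervalIntegral.integral_of_le hR,
      intervalIntegral.integral_comp_add_left (fun r : ℝ => r ^ (2 * (d : ℝ) - 3 + ε)) 1,
      integral_rpow (Or.inl (by linarith)),
      show 2 * (d : ℝ) - 3 + ε + 1 = 2 * (d : ℝ) - 2 + ε by ring, div_eq_inv_mul]
    gcongr
    have : (0 : ℝ) ≤ (1 + 0) ^ (2 * (d : ℝ) - 2 + ε) := by positivity
    linarith
  rw [← lintegral_indicator Metric.isOpen_ball.measurableSet]
  calc ∫⁻ y : V, (Metric.ball (0 : V) R).indicator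
        (fun y => ENNReal.ofReal (balanceWeight d ε ‖y‖)) y
      = ∫⁻ y : V, ENNReal.ofReal ((Iio R).indicator (balanceWeight d ε) ‖y‖) := by
        refine lintegral_congr fun y => ?_
        by_cases hy : ‖y‖ < R
        · rw [indicator_of_mem (by simpa using hy), indicator_of_mem (by simpa using hy)]
        · rw [indicator_of_notMem (by simpa using hy), indicator_of_notMem (by simpa using hy),
            ENNReal.ofReal_zero]
    _ ≤ _ := lintegral_norm_le_of_le (F := (Iio R).indicator (balanceWeight d ε))
        ((measurable_balanceWeight d ε).indicator measurableSet_Iio)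
        (fun r => indicator_nonneg (fun r _ => (balanceWeight_pos d ε r).le) r) hi ?_
    _ ≤ _ := by
        refine ENNReal.ofReal_le_ofReal ?_
        rw [mul_assoc _ _⁻¹]
        gcongr
  intro r hr
  by_cases hrR : r < R
  · rw [indicator_of_mem (show r ∈ Iio R from hrR), indicator_of_mem (show r ∈ Ioo 0 R from ⟨hr, hrR⟩),
      balanceWeight, abs_of_pos hr]
    have h1 : r ^ (d - 1) ≤ (1 + r) ^ ((d : ℝ) - 1) := by
      have : (1 + r) ^ ((d : ℝ) - 1) = (1 + r) ^ (d - 1) := by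
        rw [← Real.rpow_natCast, Nat.cast_sub hd1, Nat.cast_one]
      rw [this]
      gcongr
      linarith
    calc r ^ (d - 1) * (1 + r) ^ ((d : ℝ) - 2 + ε)
        ≤ (1 + r) ^ ((d : ℝ) - 1) * (1 + r) ^ ((d : ℝ) - 2 + ε) := by gcongr
      _ = _ := by
        rw [← Real.rpow_add (by positivity)]
        congr 1
        ring
  · rw [indicator_of_notMem (show r ∉ Iio R from hrR), mul_zero]
    exact indicator_nonneg (fun r hr => Real.rpow_nonneg (by linarith [hr.1]) _) r

end Poisson

/-! ### The square function at the center of a ball. -/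

section Local

open Filter Topology Set ComplexConjugate

lemma lintegral_mul_sq_le {α : Type*} [MeasurableSpace α] {μ : Measure α} {u v : α → ℝ≥0∞}
    (hu : AEMeasurable u μ) (hv : AEMeasurable v μ) :
    (∫⁻ x, u x * v x ∂μ) ^ 2 ≤ (∫⁻ x, u x ^ 2 ∂μ) * ∫⁻ x, v x ^ 2 ∂μ := by
  have h := ENNReal.lintegral_mul_le_Lp_mul_Lq μ Real.HolderConjugate.two_two hu hv
  simp only [ENNReal.rpow_two] at h
  calc (∫⁻ x, u x * v x ∂μ) ^ 2
      ≤ ((∫⁻ x, u x ^ 2 ∂μ) ^ (1 / 2 : ℝ) * (∫⁻ x, v x ^ 2 ∂μ) ^ (1 / 2 : ℝ)) ^ 2 :=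
        pow_le_pow_left' h 2
    _ = _ := by
        rw [mul_pow, ← ENNReal.rpow_natCast, ← ENNReal.rpow_natCast, ← ENNReal.rpow_mul,
          ← ENNReal.rpow_mul]
        norm_num

variable {V : Type*} [NormedAddCommGroup V] [InnerProductSpace ℝ V] [FiniteDimensional ℝ V]
  [MeasurableSpace V] [BorelSpace V]

/-- With `a = π² ‖y‖² / 2` the exponential is `exp (-a) * exp (-a z)`, `z = cayley t`; it is
expanded in powers of `z`. The absolute values of the terms sum to `‖F y‖`, which justifies
integrating term by term. -/
lemma hasSum_integral_mul_poissonWeight {F : V → ℂ} (hF : Integrable F) (t : ℝ) :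
    HasSum (fun k => ((-1) ^ k * ∫ y, F y * (poissonWeight k ‖y‖ : ℂ)) * cayley t ^ k)
      (∫ y, F y * Complex.exp (-Real.pi ^ 2 * ‖y‖ ^ 2 / vertLine t)) := by
  have hs : HasSum (fun k => ∫ y, F y * (poissonWeight k ‖y‖ : ℂ) * (-cayley t) ^ k)
      (∫ y, F y * Complex.exp (-Real.pi ^ 2 * ‖y‖ ^ 2 / vertLine t)) := by
    refine hasSum_integral_of_dominated_convergence (fun k y => ‖F y‖ * poissonWeight k ‖y‖)
      (fun k => ?_) (fun k => Eventually.of_forall fun y => ?_)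
      (Eventually.of_forall fun y => ?_) ?_ (Eventually.of_forall fun y => ?_)
    · refine (hF.aestronglyMeasurable.mul ?_).mul_const _
      exact Continuous.aestronglyMeasurable (by fun_prop)
    · rw [norm_mul, norm_mul, norm_pow, norm_neg, norm_cayley, one_pow, mul_one,
        Complex.norm_of_nonneg (poissonWeight_nonneg _ _)]
    · exact (hasSum_poissonWeight ‖y‖).summable.mul_left _
    · refine hF.norm.congr (Eventually.of_forall fun y => ?_)
      simp only
      rw [((hasSum_poissonWeight ‖y‖).mul_left ‖F y‖).tsum_eq, mul_one]
    · set a : ℂ := Real.pi ^ 2 * ‖y‖ ^ 2 / 2 with ha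
      have h1 : (-Real.pi ^ 2 * ‖y‖ ^ 2 / vertLine t : ℂ) = -a + a * (-cayley t) := by
        have : (-Real.pi ^ 2 * ‖y‖ ^ 2 / vertLine t : ℂ) = -a * (2 / vertLine t) := by
          rw [ha]
          ring
        rw [this, two_div_vertLine]
        ring
      have h2 := ((NormedSpace.expSeries_div_hasSum_exp (a * (-cayley t))).mul_left
        (Complex.exp (-a))).mul_left (F y)
      rw [← Complex.exp_eq_exp_ℂ, ← Complex.exp_add, ← h1] at h2
      refine h2.congr_fun fun k => ?_
      rw [poissonWeight, mul_pow]
      push_cast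
      rw [ha]
      ring
  refine hs.congr_fun fun k => ?_
  rw [integral_mul_const, neg_pow]
  ring

/-- Cauchy-Schwarz with the Poisson weight shared equally by the two factors. One Poisson weight
stays with `‖F‖²`, so that summation over `k` remains possible. -/
lemma enorm_integral_mul_poissonWeight_sq_le {F : V → ℂ} (hF : Measurable F) (ε : ℝ) (k : ℕ) :
    ‖∫ y, F y * (poissonWeight k ‖y‖ : ℂ)‖ₑ ^ 2 ≤
      (∫⁻ y, ‖F y‖ₑ ^ 2 * ENNReal.ofReal (balanceWeight (Module.finrank ℝ V) ε ‖y‖) *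
        ENNReal.ofReal (poissonWeight k ‖y‖)) *
      ∫⁻ y : V, ENNReal.ofReal (poissonWeight k ‖y‖ *
        (balanceWeight (Module.finrank ℝ V) ε ‖y‖)⁻¹) := by
  set w : V → ℝ := fun y => balanceWeight (Module.finrank ℝ V) ε ‖y‖ with hw
  have hw0 : ∀ y, 0 < w y := fun y => balanceWeight_pos _ _ _
  have hwm : Measurable w := by fun_prop
  have hp0 : ∀ y : V, 0 ≤ poissonWeight k ‖y‖ := fun y => poissonWeight_nonneg _ _
  calc ‖∫ y, F y * (poissonWeight k ‖y‖ : ℂ)‖ₑ ^ 2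
      ≤ (∫⁻ y, (‖F y‖ₑ * ENNReal.ofReal √(w y * poissonWeight k ‖y‖)) *
        ENNReal.ofReal √(poissonWeight k ‖y‖ * (w y)⁻¹)) ^ 2 := by
        refine pow_le_pow_left' ((enorm_integral_le_lintegral_enorm _).trans_eq ?_) 2
        refine lintegral_congr fun y => ?_
        have h1 : poissonWeight k ‖y‖ =
            √(w y * poissonWeight k ‖y‖) * √(poissonWeight k ‖y‖ * (w y)⁻¹) := by
          rw [← Real.sqrt_mul (mul_nonneg (hw0 y).le (hp0 y)),
            show w y * poissonWeight k ‖y‖ * (poissonWeight k ‖y‖ * (w y)⁻¹) =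
              poissonWeight k ‖y‖ ^ 2 * (w y * (w y)⁻¹) by ring, mul_inv_cancel₀ (hw0 y).ne',
            mul_one, Real.sqrt_sq (hp0 y)]
        rw [enorm_mul, mul_assoc, ← ENNReal.ofReal_mul (Real.sqrt_nonneg _), ← h1,
          ← ofReal_norm (poissonWeight k ‖y‖ : ℂ), Complex.norm_of_nonneg (hp0 y)]
    _ ≤ _ := lintegral_mul_sq_le (by fun_prop) (by fun_prop)
    _ = _ := by
        congr 1
        · refine lintegral_congr fun y => ?_
          rw [mul_pow, ← ENNReal.ofReal_pow (Real.sqrt_nonneg _),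
            Real.sq_sqrt (mul_nonneg (hw0 y).le (hp0 y)), ENNReal.ofReal_mul (hw0 y).le, mul_assoc]
        · refine lintegral_congr fun y => ?_
          rw [← ENNReal.ofReal_pow (Real.sqrt_nonneg _),
            Real.sq_sqrt (mul_nonneg (hp0 y) (inv_nonneg.2 (hw0 y).le))]

variable (V) in
/-- The square function estimate for functions supported in a ball, at its center. -/
theorem exists_lintegral_near_le [Nontrivial V] {ε : ℝ} (hε : 0 < ε) :
    ∃ D : ℝ, 0 ≤ D ∧ ∀ (F : V → ℂ) (M R : ℝ), Measurable F → 0 ≤ M → 0 ≤ R →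
      (∀ y, ‖F y‖ ≤ M) → (∀ y, R ≤ ‖y‖ → F y = 0) →
      ∫⁻ t, ‖∫ y, F y * Complex.exp (-Real.pi ^ 2 * ‖y‖ ^ 2 / vertLine t)‖ₑ ^ 2 *
          ENNReal.ofReal (1 / ‖vertLine t‖ ^ 2) ≤
        ENNReal.ofReal (D * M ^ 2 * (1 + R) ^ (2 * (Module.finrank ℝ V : ℝ) - 2 + ε)) := by
  obtain ⟨D₁, hD₁, h₁⟩ := exists_lintegral_poissonWeight_le V hε.le
  obtain ⟨D₂, hD₂, h₂⟩ := exists_lintegral_balanceWeight_le V hε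
  refine ⟨D₁ * D₂, by positivity, fun F M R hF hM hR hFM hFR => ?_⟩
  set w : V → ℝ := fun y => balanceWeight (Module.finrank ℝ V) ε ‖y‖ with hw
  have hsupp : ∀ y, y ∉ Metric.ball (0 : V) R → F y = 0 := fun y hy =>
    hFR y (by simpa using hy)
  have hFi : Integrable F := by
    have : IntegrableOn F (Metric.ball 0 R) :=
      Integrable.mono' (g := fun _ => M) (integrableOn_const measure_ball_lt_top.ne)
        hF.aestronglyMeasurable (Eventually.of_forall hFM)
    exact this.integrable_of_forall_notMem_eq_zero hsupp
  calc _ ≤ ∑' k, ‖(-1) ^ k * ∫ y, F y * (poissonWeight k ‖y‖ : ℂ)‖ₑ ^ 2 :=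
        lintegral_enorm_sq_le_tsum (hasSum_integral_mul_poissonWeight hFi)
    _ ≤ ∑' k, (∫⁻ y, ‖F y‖ₑ ^ 2 * ENNReal.ofReal (w y) *
          ENNReal.ofReal (poissonWeight k ‖y‖)) * ENNReal.ofReal D₁ := by
        refine ENNReal.tsum_le_tsum fun k => ?_
        have : ‖(-1) ^ k * ∫ y, F y * (poissonWeight k ‖y‖ : ℂ)‖ₑ =
            ‖∫ y, F y * (poissonWeight k ‖y‖ : ℂ)‖ₑ := by
          rw [enorm_mul, enorm_pow, enorm_neg, enorm_one, one_pow, one_mul]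
        rw [this]
        refine (enorm_integral_mul_poissonWeight_sq_le hF ε k).trans ?_
        gcongr
        exact h₁ k
    -- The Poisson weights sum to one at every `y`, so summing over `k` costs nothing.
    _ = (∫⁻ y, ‖F y‖ₑ ^ 2 * ENNReal.ofReal (w y)) * ENNReal.ofReal D₁ := by
        rw [ENNReal.tsum_mul_right, ← lintegral_tsum fun k => by fun_prop]
        congr 1
        refine lintegral_congr fun y => ?_
        rw [ENNReal.tsum_mul_left, ← ENNReal.ofReal_tsum_of_nonneg
          (fun k => poissonWeight_nonneg k _) (hasSum_poissonWeight _).summable,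
          (hasSum_poissonWeight _).tsum_eq, ENNReal.ofReal_one, mul_one]
    _ ≤ (ENNReal.ofReal (M ^ 2) * ∫⁻ y in Metric.ball (0 : V) R, ENNReal.ofReal (w y)) *
          ENNReal.ofReal D₁ := by
        rw [← lintegral_const_mul' _ _ ENNReal.ofReal_ne_top,
          ← lintegral_indicator Metric.isOpen_ball.measurableSet]
        gcongr with y
        by_cases hy : y ∈ Metric.ball (0 : V) R
        · rw [indicator_of_mem hy, ENNReal.ofReal_pow hM, ← ofReal_norm]
          gcongr
          exact hFM y
        · rw [hsupp y hy]
          simp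
    _ ≤ (ENNReal.ofReal (M ^ 2) * ENNReal.ofReal
          (D₂ * (1 + R) ^ (2 * (Module.finrank ℝ V : ℝ) - 2 + ε))) * ENNReal.ofReal D₁ := by
        gcongr
        exact h₂ R hR
    _ = _ := by
        rw [← ENNReal.ofReal_mul (by positivity), ← ENNReal.ofReal_mul (by positivity)]
        congr 1
        ring

end Local

/-! ### Dyadic square functions: the `L²` and `L^∞` bounds. -/

section SquareFunction

open Filter Topology Set

lemma exists_mul_exp_neg_rpow_le {κ s : ℝ} (hκ : 0 < κ) (hs : 0 < s) :
    ∃ C : ℝ, 0 ≤ C ∧ ∀ X : ℝ, 0 < X → X * Real.exp (-κ * X ^ s) ≤ C := by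
  -- The constant comes from `log u ≤ u - 1` at `u = κ s X ^ s`.
  refine ⟨Real.exp (-(1 + Real.log (κ * s)) / s), by positivity, fun X hX => ?_⟩
  have h1 := Real.log_le_sub_one_of_pos (show 0 < κ * s * X ^ s by positivity)
  rw [Real.log_mul (by positivity) (by positivity), Real.log_rpow hX] at h1
  have h2 : X = Real.exp (Real.log X) := (Real.exp_log hX).symm
  nth_rewrite 1 [h2]
  rw [← Real.exp_add, Real.exp_le_exp, le_div_iff₀ hs]
  nlinarith

/-- The dyadic part of the line `Re b = 1` on which `2 ^ j ≤ ‖b‖ < 2 ^ (j + 1)`. -/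
def dyadicBlock (j : ℕ) : Set ℝ := {t | (2 : ℝ) ^ j ≤ ‖vertLine t‖ ∧ ‖vertLine t‖ < 2 ^ (j + 1)}

lemma measurableSet_dyadicBlock (j : ℕ) : MeasurableSet (dyadicBlock j) := by
  have h1 : MeasurableSet {t | (2 : ℝ) ^ j ≤ ‖vertLine t‖} :=
    measurableSet_le measurable_const measurable_vertLine.norm
  have h2 : MeasurableSet {t | ‖vertLine t‖ < 2 ^ (j + 1)} :=
    measurableSet_lt measurable_vertLine.norm measurable_const
  exact h1.inter h2

lemma iUnion_dyadicBlock : ⋃ j, dyadicBlock j = univ := by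
  refine eq_univ_of_forall fun t => mem_iUnion.2 ?_
  exact exists_nat_pow_near (one_le_norm_vertLine t) one_lt_two

lemma volume_dyadicBlock_le (j : ℕ) : volume (dyadicBlock j) ≤ ENNReal.ofReal (2 * 2 ^ j) := by
  have hsub : dyadicBlock j ⊆ Icc (-2 ^ j) (2 ^ j) := by
    intro t ht
    rw [mem_Icc, ← abs_le]
    refine abs_le_of_sq_le_sq ?_ (by positivity)
    have h1 : ‖vertLine t‖ ^ 2 ≤ (2 ^ (j + 1)) ^ 2 :=
      pow_le_pow_left₀ (norm_nonneg _) ht.2.le 2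
    rw [norm_vertLine_sq, pow_succ (2 : ℝ) j] at h1
    have h2 : (3 : ℝ) ^ 2 ≤ Real.pi ^ 2 := pow_le_pow_left₀ (by norm_num) Real.pi_gt_three.le 2
    nlinarith [sq_nonneg t, mul_nonneg (sq_nonneg t) (sub_nonneg.2 h2)]
  refine (measure_mono hsub).trans_eq ?_
  rw [Real.volume_Icc]
  congr 1
  ring

variable {V : Type*} [NormedAddCommGroup V] [InnerProductSpace ℝ V] [FiniteDimensional ℝ V]
  [MeasurableSpace V] [BorelSpace V]

/-- Half of the Gaussian exponent yields the decay in `R`; the other half keeps the kernel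
integrable. -/
lemma norm_integral_far_le {b : ℂ} (hb : b.re = 1) {F : V → ℂ} {M R : ℝ}
    (hM : 0 ≤ M) (hR : 0 ≤ R) (hFM : ∀ y, ‖F y‖ ≤ M) (hFR : ∀ y, ‖y‖ < R → F y = 0) :
    ‖∫ y, gaussKer b y * F y‖ ≤ M * (2 * ‖b‖) ^ (Module.finrank ℝ V / 2 : ℝ) *
      Real.exp (-Real.pi ^ 2 * R ^ 2 / (2 * ‖b‖ ^ 2)) := by
  have hb0 : b ≠ 0 := by
    rintro rfl
    simp at hb
  have hbn : 0 < ‖b‖ := norm_pos_iff.2 hb0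
  set κ : ℝ := Real.pi ^ 2 / (2 * ‖b‖ ^ 2) with hκ
  have hκ0 : 0 < κ := by positivity
  set c : ℝ := M * (Real.pi / ‖b‖) ^ (Module.finrank ℝ V / 2 : ℝ) * Real.exp (-κ * R ^ 2) with hc
  refine (norm_integral_le_of_norm_le ((integrable_exp_neg_mul_sq_norm (V := V) hκ0).const_mul c)
    (Eventually.of_forall fun y => ?_)).trans_eq ?_
  · by_cases hy : ‖y‖ < R
    · rw [hFR y hy]
      simp only [mul_zero, norm_zero]
      positivity
    · rw [not_lt] at hy
      rw [norm_mul, norm_gaussKer b hb0, hb, hc]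
      have h1 : Real.exp (-(Real.pi ^ 2 * (1 / ‖b‖ ^ 2)) * ‖y‖ ^ 2) ≤
          Real.exp (-κ * R ^ 2) * Real.exp (-κ * ‖y‖ ^ 2) := by
        rw [← Real.exp_add, Real.exp_le_exp]
        have h2 : Real.pi ^ 2 * (1 / ‖b‖ ^ 2) = κ + κ := by
          rw [hκ]
          field_simp
          norm_num
        rw [h2]
        have h3 : κ * R ^ 2 ≤ κ * ‖y‖ ^ 2 := by gcongr
        linarith
      calc _ ≤ (Real.pi / ‖b‖) ^ (Module.finrank ℝ V / 2 : ℝ) *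
            (Real.exp (-κ * R ^ 2) * Real.exp (-κ * ‖y‖ ^ 2)) * M := by
            gcongr
            exact hFM y
        _ = _ := by ring
  · rw [integral_const_mul, GaussianFourier.integral_rexp_neg_mul_sq_norm hκ0, hc]
    have h1 : (2 * ‖b‖) ^ (Module.finrank ℝ V / 2 : ℝ) =
        (Real.pi / ‖b‖) ^ (Module.finrank ℝ V / 2 : ℝ) *
          (Real.pi / κ) ^ (Module.finrank ℝ V / 2 : ℝ) := by
      rw [← Real.mul_rpow (by positivity) (by positivity)]
      congr 1
      rw [hκ]
      field_simp
    rw [h1, show -Real.pi ^ 2 * R ^ 2 / (2 * ‖b‖ ^ 2) = -κ * R ^ 2 by rw [hκ]; ring]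
    ring

/-- The local square function of the multipliers `exp (-b ‖ξ‖²)` over a dyadic part of the line
`Re b = 1`. -/
noncomputable def squareFn (j : ℕ) (f : V → ℂ) (x : V) : ℝ≥0∞ :=
  (∫⁻ t in dyadicBlock j, ‖heatOp (vertLine t) f x‖ₑ ^ 2) ^ (1 / 2 : ℝ)

lemma squareFn_sq (j : ℕ) (f : V → ℂ) (x : V) :
    squareFn j f x ^ 2 = ∫⁻ t in dyadicBlock j, ‖heatOp (vertLine t) f x‖ₑ ^ 2 := by
  rw [squareFn, ← ENNReal.rpow_natCast, ← ENNReal.rpow_mul]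
  norm_num

lemma measurable_heatOp_vertLine {f : V → ℂ} (hf : Measurable f) :
    Measurable fun q : V × ℝ => heatOp (vertLine q.2) f q.1 :=
  measurable_heatOp (measurable_vertLine.comp measurable_snd) measurable_fst hf

lemma measurable_squareFn (j : ℕ) {f : V → ℂ} (hf : Measurable f) :
    Measurable (squareFn j f) := by
  unfold squareFn
  exact (((measurable_heatOp_vertLine hf).enorm.pow_const 2).lintegral_prod_right').pow_const _

lemma squareFn_add_le (j : ℕ) {p q : ℝ≥0∞} (hp : 1 ≤ p) (hq : 1 ≤ q) {f g : V → ℂ}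
    (hf : MemLp f p) (hg : MemLp g q) (hfm : Measurable f) (hgm : Measurable g) (x : V) :
    squareFn j (f + g) x ≤ squareFn j f x + squareFn j g x := by
  have hm : ∀ {h : V → ℂ}, Measurable h → AEMeasurable
      (fun t => ‖heatOp (vertLine t) h x‖ₑ) (volume.restrict (dyadicBlock j)) := fun hh =>
    (measurable_heatOp measurable_vertLine measurable_const hh).enorm.aemeasurable
  have h := ENNReal.lintegral_Lp_add_le (hm hfm) (hm hgm) one_le_two
  simp only [ENNReal.rpow_two] at h
  refine le_trans ?_ h
  unfold squareFn
  gcongr with t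
  rw [heatOp_add (vertLine_re_pos t) hp hq hf hg, Pi.add_apply]
  exact enorm_add_le _ _

/-- The `L²` bound for the local square function. -/
theorem lintegral_squareFn_sq_le (j : ℕ) {f : V → ℂ} (hfm : Measurable f) (hf : MemLp f 2) :
    ∫⁻ x, squareFn j f x ^ 2 ≤ ENNReal.ofReal (2 * 2 ^ j) * ∫⁻ x, ‖f x‖ₑ ^ 2 := by
  have hL2 : ∀ g : V → ℂ, ∫⁻ x, ‖g x‖ₑ ^ 2 = eLpNorm g 2 ^ 2 := fun g => by
    rw [eLpNorm_eq_lintegral_rpow_enorm_toReal two_ne_zero ENNReal.ofNat_ne_top,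
      ← ENNReal.rpow_natCast, ← ENNReal.rpow_mul]
    norm_num
  simp only [squareFn_sq]
  rw [lintegral_lintegral_swap
    ((measurable_heatOp_vertLine hfm).enorm.pow_const 2).aemeasurable]
  calc ∫⁻ t in dyadicBlock j, ∫⁻ x, ‖heatOp (vertLine t) f x‖ₑ ^ 2
      ≤ ∫⁻ _ in dyadicBlock j, ∫⁻ x, ‖f x‖ₑ ^ 2 := by
        refine lintegral_mono fun t => ?_
        rw [hL2, hL2]
        exact pow_le_pow_left' (eLpNorm_heatOp_le (vertLine_re_pos t) hf) 2
    _ = volume (dyadicBlock j) * ∫⁻ x, ‖f x‖ₑ ^ 2 := by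
        rw [lintegral_const, Measure.restrict_apply_univ, mul_comm]
    _ ≤ _ := by
        gcongr
        exact volume_dyadicBlock_le j

lemma gaussKer_eq_mul (b : ℂ) (y : V) : gaussKer b y =
    (Real.pi / b) ^ (Module.finrank ℝ V / 2 : ℂ) *
      Complex.exp (-Real.pi ^ 2 * ‖y‖ ^ 2 / b) := rfl

lemma norm_cpow_finrank (b : ℂ) (hb : b ≠ 0) (d : ℕ) :
    ‖(Real.pi / b : ℂ) ^ (d / 2 : ℂ)‖ ^ 2 = (Real.pi / ‖b‖) ^ d := by
  have h1 : (Real.pi / b : ℂ) ≠ 0 := div_ne_zero (by exact_mod_cast Real.pi_ne_zero) hb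
  rw [show (d / 2 : ℂ) = ((d / 2 : ℝ) : ℂ) by push_cast; rfl,
    Complex.norm_cpow_real, norm_div, Complex.norm_of_nonneg Real.pi_pos.le,
    ← Real.rpow_natCast, ← Real.rpow_mul (by positivity), ← Real.rpow_natCast]
  congr 1
  push_cast
  ring

variable (V) in
/-- The `L^∞` bound for the local square function. -/
theorem exists_squareFn_le [Nontrivial V] {η : ℝ} (hη : 0 < η) :
    ∃ C : ℝ, 0 < C ∧ ∀ (j : ℕ) (f : V → ℂ) (M : ℝ) (x : V), Measurable f → 0 ≤ M →
      (∀ y, ‖f y‖ ≤ M) → squareFn j f x ≤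
        ENNReal.ofReal (C * (2 ^ j : ℝ) ^ (Module.finrank ℝ V / 2 + η : ℝ) * M) := by
  set d := Module.finrank ℝ V with hd
  have hd1 : 1 ≤ d := Module.finrank_pos
  have hd1' : (1 : ℝ) ≤ d := by exact_mod_cast hd1
  -- Chosen so that `(1 + ε)(2d - 2 + ε) ≤ 2d - 2 + 2η`: the excess on the left is at most `2 d ε`.
  set ε : ℝ := min 1 (η / d) with hε
  have hε0 : 0 < ε := lt_min one_pos (by positivity)
  have hε1 : ε ≤ 1 := min_le_left _ _
  have hεη : ε * d ≤ η := by
    have := min_le_right 1 (η / d)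
    rwa [← hε, le_div_iff₀ (by positivity)] at this
  set s : ℝ := 2 * (d : ℝ) - 2 + ε with hs
  have hs0 : 0 < s := by linarith
  obtain ⟨D, hD, hnear⟩ := exists_lintegral_near_le V hε0
  obtain ⟨E, hE, hexp⟩ := exists_mul_exp_neg_rpow_le (κ := Real.pi ^ 2 / 4) (s := 2 * ε)
    (by positivity) (by positivity)
  -- The near and far constants, doubled by `(a + b)² ≤ 2a² + 2b²`; the final `1` only ensures
  -- positivity.
  set C₀ : ℝ := 2 * (4 * Real.pi ^ d * D * 2 ^ s) + 2 * (2 * 4 ^ d * E) + 1 with hC₀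
  have hC₀0 : 0 < C₀ := by positivity
  refine ⟨√C₀, by positivity, fun j f M x hf hM hfM => ?_⟩
  set N : ℝ := 2 ^ j with hN
  have hN1 : 1 ≤ N := one_le_pow₀ one_le_two
  have hN0 : 0 < N := by positivity
  -- Slightly beyond the scale `N` of the kernel, so that the far part gains `exp (-c N ^ (2ε))`,
  -- which absorbs the length of the block.
  set R : ℝ := N ^ (1 + ε) with hR
  have hR1 : 1 ≤ R := Real.one_le_rpow hN1 (by linarith)
  set F₁ : V → ℂ := (Metric.ball (0 : V) R).indicator fun y => f (x - y) with hF₁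
  set F₂ : V → ℂ := (Metric.ball (0 : V) R)ᶜ.indicator fun y => f (x - y) with hF₂
  have hfx : Measurable fun y => f (x - y) := hf.comp (by fun_prop)
  have hF₁m : Measurable F₁ := hfx.indicator Metric.isOpen_ball.measurableSet
  have hF₂m : Measurable F₂ := hfx.indicator Metric.isOpen_ball.measurableSet.compl
  have hF₁M : ∀ y, ‖F₁ y‖ ≤ M := fun y => (norm_indicator_le_norm_self _ _).trans (hfM _)
  have hF₂M : ∀ y, ‖F₂ y‖ ≤ M := fun y => (norm_indicator_le_norm_self _ _).trans (hfM _)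
  have hsplit : ∀ t, heatOp (vertLine t) f x = (∫ y, gaussKer (vertLine t) y * F₁ y) +
      ∫ y, gaussKer (vertLine t) y * F₂ y := by
    intro t
    have hK : Integrable (gaussKer (vertLine t) : V → ℂ) :=
      memLp_one_iff_integrable.1 (memLp_gaussKer (vertLine_re_pos t) 1)
    rw [← integral_add (hK.mul_bdd (c := M) hF₁m.aestronglyMeasurable (Eventually.of_forall hF₁M))
      (hK.mul_bdd (c := M) hF₂m.aestronglyMeasurable (Eventually.of_forall hF₂M)), heatOp,
      ← integral_sub_left_eq_self _ volume x]
    refine integral_congr_ae (Eventually.of_forall fun y => ?_)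
    simp only [sub_sub_cancel]
    rw [← mul_add, hF₁, hF₂, ← Pi.add_apply, indicator_self_add_compl]
  set H : ℝ → ℂ := fun t => ∫ y, F₁ y * Complex.exp (-Real.pi ^ 2 * ‖y‖ ^ 2 / vertLine t) with hH
  have hptn : ∀ t ∈ dyadicBlock j, ‖∫ y, gaussKer (vertLine t) y * F₁ y‖ₑ ^ 2 ≤
      ENNReal.ofReal (4 * Real.pi ^ d * N ^ (2 - d : ℝ)) *
        (‖H t‖ₑ ^ 2 * ENNReal.ofReal (1 / ‖vertLine t‖ ^ 2)) := by
    intro t ht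
    have h1 : ∫ y, gaussKer (vertLine t) y * F₁ y =
        (Real.pi / vertLine t) ^ (d / 2 : ℂ) * H t := by
      rw [hH, ← integral_const_mul]
      refine integral_congr_ae (Eventually.of_forall fun y => ?_)
      simp only [gaussKer_eq_mul]
      ring
    have hb := norm_vertLine_pos t
    rw [h1, ← ofReal_norm, ← ofReal_norm, ← ENNReal.ofReal_pow (norm_nonneg _),
      ← ENNReal.ofReal_pow (norm_nonneg _), ← ENNReal.ofReal_mul (by positivity),
      ← ENNReal.ofReal_mul (by positivity), norm_mul, mul_pow,
      norm_cpow_finrank _ (vertLine_ne_zero t)]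
    refine ENNReal.ofReal_le_ofReal ?_
    -- On the block `‖b‖` is comparable to `N`, so the kernel prefactor can be traded for the
    -- arc-length density `1 / ‖b‖²` that Bessel's inequality requires.
    have h2 : (Real.pi / ‖vertLine t‖) ^ d ≤
        4 * Real.pi ^ d * N ^ (2 - d : ℝ) * (1 / ‖vertLine t‖ ^ 2) := by
      have h3 : ‖vertLine t‖ ^ 2 ≤ 4 * N ^ 2 := by
        have := pow_le_pow_left₀ hb.le ht.2.le 2
        rw [pow_succ (2 : ℝ) j, mul_pow] at this
        linarith
      have h4 : N ^ (2 - d : ℝ) = N ^ 2 / N ^ d := by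
        rw [Real.rpow_sub hN0, Real.rpow_natCast, Real.rpow_two]
      rw [h4, mul_one_div, le_div_iff₀ (by positivity)]
      calc (Real.pi / ‖vertLine t‖) ^ d * ‖vertLine t‖ ^ 2
          ≤ (Real.pi / N) ^ d * (4 * N ^ 2) := by
            gcongr
            exact ht.1
        _ = _ := by
            rw [div_pow]
            ring
    calc (Real.pi / ‖vertLine t‖) ^ d * ‖H t‖ ^ 2
        ≤ 4 * Real.pi ^ d * N ^ (2 - d : ℝ) * (1 / ‖vertLine t‖ ^ 2) * ‖H t‖ ^ 2 := by gcongr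
      _ = _ := by ring
  have hnear' : ∫⁻ t in dyadicBlock j, ‖∫ y, gaussKer (vertLine t) y * F₁ y‖ₑ ^ 2 ≤
      ENNReal.ofReal (4 * Real.pi ^ d * D * 2 ^ s * M ^ 2 * N ^ (d + 2 * η : ℝ)) := by
    calc _ ≤ ∫⁻ t in dyadicBlock j, ENNReal.ofReal (4 * Real.pi ^ d * N ^ (2 - d : ℝ)) *
          (‖H t‖ₑ ^ 2 * ENNReal.ofReal (1 / ‖vertLine t‖ ^ 2)) :=
          setLIntegral_mono' (measurableSet_dyadicBlock j) hptn
      _ ≤ ENNReal.ofReal (4 * Real.pi ^ d * N ^ (2 - d : ℝ)) *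
          ENNReal.ofReal (D * M ^ 2 * (1 + R) ^ s) := by
          rw [lintegral_const_mul' _ _ ENNReal.ofReal_ne_top]
          refine mul_le_mul_right ((setLIntegral_le_lintegral _ _).trans ?_) _
          refine hnear F₁ M R hF₁m hM (by linarith) hF₁M fun y hy => ?_
          exact indicator_of_notMem (by simpa using hy) _
      _ ≤ _ := by
          rw [← ENNReal.ofReal_mul (by positivity)]
          refine ENNReal.ofReal_le_ofReal ?_
          have h1 : (1 + R) ^ s ≤ 2 ^ s * N ^ ((1 + ε) * s) := by
            rw [Real.rpow_mul hN0.le, ← hR, ← Real.mul_rpow (by norm_num) (by linarith)]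
            exact Real.rpow_le_rpow (by linarith) (by linarith) hs0.le
          have h2 : N ^ (2 - d : ℝ) * N ^ ((1 + ε) * s) ≤ N ^ (d + 2 * η : ℝ) := by
            rw [← Real.rpow_add hN0]
            refine Real.rpow_le_rpow_of_exponent_le hN1 ?_
            rw [hs]
            nlinarith
          calc 4 * Real.pi ^ d * N ^ (2 - d : ℝ) * (D * M ^ 2 * (1 + R) ^ s)
              ≤ 4 * Real.pi ^ d * N ^ (2 - d : ℝ) * (D * M ^ 2 * (2 ^ s * N ^ ((1 + ε) * s))) := by
                gcongr
            _ = 4 * Real.pi ^ d * D * 2 ^ s * M ^ 2 * (N ^ (2 - d : ℝ) * N ^ ((1 + ε) * s)) := by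
                ring
            _ ≤ _ := by gcongr
  have hfar : ∫⁻ t in dyadicBlock j, ‖∫ y, gaussKer (vertLine t) y * F₂ y‖ₑ ^ 2 ≤
      ENNReal.ofReal (2 * 4 ^ d * E * M ^ 2 * N ^ (d + 2 * η : ℝ)) := by
    have hpt : ∀ t ∈ dyadicBlock j, ‖∫ y, gaussKer (vertLine t) y * F₂ y‖ₑ ^ 2 ≤
        ENNReal.ofReal (M ^ 2 * (4 * N) ^ d * Real.exp (-(Real.pi ^ 2 / 4) * N ^ (2 * ε))) := by
      intro t ht
      have hb := norm_vertLine_pos t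
      have hb2 : ‖vertLine t‖ ≤ 2 * N := by
        have := ht.2.le
        rw [pow_succ (2 : ℝ) j] at this
        linarith
      rw [← ofReal_norm, ← ENNReal.ofReal_pow (norm_nonneg _)]
      refine ENNReal.ofReal_le_ofReal ?_
      have h1 := norm_integral_far_le (vertLine_re t) hM (by linarith) hF₂M (R := R) fun y hy =>
        indicator_of_notMem (by simpa using hy) _
      have h2 : Real.exp (-Real.pi ^ 2 * R ^ 2 / (2 * ‖vertLine t‖ ^ 2)) ≤
          Real.exp (-(Real.pi ^ 2 / 8) * N ^ (2 * ε)) := by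
        rw [Real.exp_le_exp]
        have h3 : R ^ 2 = N ^ 2 * N ^ (2 * ε) := by
          rw [hR, ← Real.rpow_natCast, ← Real.rpow_mul hN0.le, ← Real.rpow_natCast,
            ← Real.rpow_add hN0]
          congr 1
          push_cast
          ring
        rw [h3, div_le_iff₀ (by positivity)]
        have h4 : ‖vertLine t‖ ^ 2 ≤ 4 * N ^ 2 := by
          have := pow_le_pow_left₀ hb.le hb2 2
          linarith
        have h5 : 0 ≤ Real.pi ^ 2 / 8 * N ^ (2 * ε) := by positivity
        have h6 := mul_le_mul_of_nonneg_left h4 h5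
        linarith
      calc _ ≤ (M * (2 * (2 * N)) ^ (d / 2 : ℝ) *
            Real.exp (-(Real.pi ^ 2 / 8) * N ^ (2 * ε))) ^ 2 := by
            refine pow_le_pow_left₀ (norm_nonneg _) (h1.trans ?_) 2
            gcongr
        _ = _ := by
            rw [mul_pow, mul_pow, ← Real.exp_nat_mul, show 2 * (2 * N) = 4 * N by ring,
              ← Real.rpow_natCast ((4 * N) ^ _), ← Real.rpow_mul (by positivity),
              ← Real.rpow_natCast (4 * N)]
            congr 2
            · congr 2
              push_cast
              ring
            · push_cast
              ring
    calc _ ≤ ∫⁻ _ in dyadicBlock j, ENNReal.ofReal (M ^ 2 * (4 * N) ^ d *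
          Real.exp (-(Real.pi ^ 2 / 4) * N ^ (2 * ε))) :=
          setLIntegral_mono' (measurableSet_dyadicBlock j) hpt
      _ ≤ ENNReal.ofReal (M ^ 2 * (4 * N) ^ d *
          Real.exp (-(Real.pi ^ 2 / 4) * N ^ (2 * ε))) * ENNReal.ofReal (2 * N) := by
          rw [lintegral_const, Measure.restrict_apply_univ]
          gcongr
          exact volume_dyadicBlock_le j
      _ ≤ _ := by
          rw [← ENNReal.ofReal_mul (by positivity)]
          refine ENNReal.ofReal_le_ofReal ?_
          have h1 : N ^ d ≤ N ^ (d + 2 * η : ℝ) := by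
            rw [← Real.rpow_natCast]
            exact Real.rpow_le_rpow_of_exponent_le hN1 (by linarith)
          calc M ^ 2 * (4 * N) ^ d * Real.exp (-(Real.pi ^ 2 / 4) * N ^ (2 * ε)) * (2 * N)
              = 2 * 4 ^ d * (N * Real.exp (-(Real.pi ^ 2 / 4) * N ^ (2 * ε))) * M ^ 2 * N ^ d := by
                rw [mul_pow]
                ring
            _ ≤ _ := by
                gcongr
                exact hexp N hN0
  have hm : ∀ {F : V → ℂ}, Measurable F →
      Measurable fun t => ‖∫ y, gaussKer (vertLine t) y * F y‖ₑ ^ 2 := by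
    intro F hF
    have : StronglyMeasurable fun t => ∫ y, gaussKer (vertLine t) y * F y := by
      have h1 : Measurable fun q : ℝ × V => gaussKer (vertLine q.1) q.2 * F q.2 :=
        (measurable_gaussKer_comp (measurable_vertLine.comp measurable_fst) measurable_snd).mul
          (hF.comp measurable_snd)
      exact h1.stronglyMeasurable.integral_prod_right' (ν := volume)
    exact this.measurable.enorm.pow_const 2
  have hsum : ∫⁻ t in dyadicBlock j, ‖heatOp (vertLine t) f x‖ₑ ^ 2 ≤
      ENNReal.ofReal (C₀ * M ^ 2 * N ^ (d + 2 * η : ℝ)) := by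
    calc _ ≤ ∫⁻ t in dyadicBlock j, (2 * ‖∫ y, gaussKer (vertLine t) y * F₁ y‖ₑ ^ 2 +
          2 * ‖∫ y, gaussKer (vertLine t) y * F₂ y‖ₑ ^ 2) := by
          refine lintegral_mono fun t => ?_
          rw [hsplit, ← mul_add]
          refine (pow_le_pow_left' (enorm_add_le _ _) 2).trans ?_
          have := ENNReal.rpow_add_le_mul_rpow_add_rpow
            ‖∫ y, gaussKer (vertLine t) y * F₁ y‖ₑ ‖∫ y, gaussKer (vertLine t) y * F₂ y‖ₑ
            one_le_two
          norm_num at this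
          exact this
      _ ≤ 2 * ENNReal.ofReal (4 * Real.pi ^ d * D * 2 ^ s * M ^ 2 * N ^ (d + 2 * η : ℝ)) +
          2 * ENNReal.ofReal (2 * 4 ^ d * E * M ^ 2 * N ^ (d + 2 * η : ℝ)) := by
          rw [lintegral_add_left ((hm hF₁m).const_mul 2),
            lintegral_const_mul' _ _ ENNReal.ofNat_ne_top,
            lintegral_const_mul' _ _ ENNReal.ofNat_ne_top]
          gcongr
      _ ≤ _ := by
          rw [← ENNReal.ofReal_ofNat, ← ENNReal.ofReal_mul (by norm_num),
            ← ENNReal.ofReal_mul (by norm_num), ← ENNReal.ofReal_add (by positivity) (by positivity)]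
          refine ENNReal.ofReal_le_ofReal ?_
          have : 0 ≤ M ^ 2 * N ^ (d + 2 * η : ℝ) := by positivity
          rw [hC₀]
          linarith
  calc squareFn j f x ≤ (ENNReal.ofReal (C₀ * M ^ 2 * N ^ (d + 2 * η : ℝ))) ^ (1 / 2 : ℝ) := by
        unfold squareFn
        gcongr
    _ = _ := by
        rw [ENNReal.ofReal_rpow_of_nonneg (by positivity) (by norm_num)]
        congr 1
        rw [Real.mul_rpow (by positivity) (by positivity),
          Real.mul_rpow (by positivity) (by positivity), ← Real.sqrt_eq_rpow,
          ← Real.sqrt_eq_rpow (M ^ 2), Real.sqrt_sq hM, ← Real.rpow_mul hN0.le,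
          show ((d : ℝ) + 2 * η) * (1 / 2) = d / 2 + η by ring]
        ring

end SquareFunction

/-! ### The `L^p` bound for the square functions. -/

section SquareFunctionLp

open Filter Topology Set

variable {V : Type*} [NormedAddCommGroup V] [InnerProductSpace ℝ V] [FiniteDimensional ℝ V]
  [MeasurableSpace V] [BorelSpace V]

lemma lintegral_enorm_rpow_ne_top {p : ℝ} (hp : 0 < p) {f : V → ℂ}
    (hf : MemLp f (ENNReal.ofReal p)) : ∫⁻ x, ‖f x‖ₑ ^ p ≠ ⊤ := by
  have := lintegral_rpow_enorm_lt_top_of_eLpNorm_lt_top (by simpa using hp)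
    ENNReal.ofReal_ne_top hf.2
  rw [ENNReal.toReal_ofReal hp.le] at this
  exact this.ne

lemma memLp_two_indicator_lt_norm {p l : ℝ} (hp : 2 ≤ p) (hl : 0 < l) {f : V → ℂ}
    (hfm : Measurable f) (hf : MemLp f (ENNReal.ofReal p)) :
    MemLp ({x | l < ‖f x‖}.indicator f) 2 := by
  have hset : MeasurableSet {x | l < ‖f x‖} := measurableSet_lt measurable_const hfm.norm
  refine ⟨(hfm.indicator hset).aestronglyMeasurable, ?_⟩
  rw [eLpNorm_lt_top_iff_lintegral_rpow_enorm_lt_top two_ne_zero ENNReal.ofNat_ne_top]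
  simp only [ENNReal.toReal_ofNat]
  have h1 : ∀ x, ‖{x | l < ‖f x‖}.indicator f x‖ₑ ^ (2 : ℝ) ≤
      ENNReal.ofReal (l ^ (2 - p)) * ‖f x‖ₑ ^ p := by
    intro x
    by_cases hx : l < ‖f x‖
    · rw [indicator_of_mem (show x ∈ {x | l < ‖f x‖} from hx), ← ofReal_norm,
        ENNReal.ofReal_rpow_of_nonneg (norm_nonneg _) (by norm_num),
        ENNReal.ofReal_rpow_of_nonneg (norm_nonneg _) (by linarith),
        ← ENNReal.ofReal_mul (by positivity)]
      refine ENNReal.ofReal_le_ofReal ?_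
      have h0 : 0 < ‖f x‖ := hl.trans hx
      calc ‖f x‖ ^ (2 : ℝ) = ‖f x‖ ^ (2 - p) * ‖f x‖ ^ p := by
            rw [← Real.rpow_add h0, sub_add_cancel]
        _ ≤ _ := mul_le_mul_of_nonneg_right
            (Real.rpow_le_rpow_of_nonpos hl hx.le (by linarith)) (by positivity)
    · rw [indicator_of_notMem (show x ∉ {x | l < ‖f x‖} from hx)]
      simp
  refine (lintegral_mono h1).trans_lt ?_
  rw [lintegral_const_mul' _ _ ENNReal.ofReal_ne_top]
  exact ENNReal.mul_lt_top ENNReal.ofReal_lt_top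
    (lintegral_enorm_rpow_ne_top (by linarith) hf).lt_top

variable (V) in
/-- The `L^p` bound for the local square function, `2 ≤ p < ∞`. -/
theorem exists_lintegral_squareFn_rpow_le [Nontrivial V] {p η : ℝ} (hp : 2 ≤ p) (hη : 0 < η) :
    ∃ C : ℝ, 0 < C ∧ ∀ (j : ℕ) (f : V → ℂ), Measurable f → MemLp f (ENNReal.ofReal p) →
      (∫⁻ x, squareFn j f x ^ p) ^ (1 / p) ≤ ENNReal.ofReal (C * (2 ^ j : ℝ) ^
        (Module.finrank ℝ V / 2 - (Module.finrank ℝ V - 1) / p + η : ℝ)) *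
        (∫⁻ x, ‖f x‖ₑ ^ p) ^ (1 / p) := by
  set d := Module.finrank ℝ V with hd
  have hp0 : 0 < p := by linarith
  rcases hp.eq_or_lt with rfl | hp2
  -- The endpoint `p = 2` is separate because the interpolation constant contains `1 / (p - 2)`.
  · refine ⟨√2, by positivity, fun j f hfm hf => ?_⟩
    rw [ENNReal.ofReal_ofNat] at hf
    have h := lintegral_squareFn_sq_le j hfm hf
    simp only [← ENNReal.rpow_two] at h
    refine (ENNReal.rpow_le_rpow h (by norm_num : (0 : ℝ) ≤ 1 / 2)).trans ?_
    rw [ENNReal.mul_rpow_of_nonneg _ _ (by norm_num)]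
    gcongr
    rw [ENNReal.ofReal_rpow_of_nonneg (by positivity) (by norm_num)]
    refine ENNReal.ofReal_le_ofReal ?_
    rw [Real.mul_rpow (by norm_num) (by positivity), ← Real.sqrt_eq_rpow]
    gcongr
    · exact one_le_pow₀ one_le_two
    · linarith
  · obtain ⟨C, hC, hbound⟩ := exists_squareFn_le V hη
    have hp2' : 0 < p - 2 := by linarith
    set c : ℝ := 4 * p / (p - 2) * (2 * C) ^ (p - 2) * 2 with hc
    have hc0 : 0 < c := by positivity
    refine ⟨c ^ (1 / p), by positivity, fun j f hfm hf => ?_⟩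
    set N : ℝ := 2 ^ j with hN
    have hN1 : 1 ≤ N := one_le_pow₀ one_le_two
    have hN0 : 0 < N := by positivity
    have hmain : ∫⁻ x, squareFn j f x ^ p ≤
        ENNReal.ofReal (4 * p / (p - 2) * (2 * (C * N ^ (d / 2 + η : ℝ))) ^ (p - 2)) *
          ENNReal.ofReal (2 * N) * ∫⁻ x, ‖f x‖ₑ ^ p := by
      refine lintegral_rpow_le_of_truncation hp2 (by positivity) ENNReal.ofReal_ne_top hfm
        (lintegral_enorm_rpow_ne_top hp0 hf) (measurable_squareFn j hfm).aemeasurable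
        fun l hl => ?_
      have hset : MeasurableSet {x | l < ‖f x‖} := measurableSet_lt measurable_const hfm.norm
      set fb := {x | l < ‖f x‖}.indicator f with hfb
      set fs := {x | l < ‖f x‖}ᶜ.indicator f with hfs
      have hfbm : Measurable fb := hfm.indicator hset
      have hfsm : Measurable fs := hfm.indicator hset.compl
      have hfsl : ∀ x, ‖fs x‖ ≤ l := by
        intro x
        by_cases hx : l < ‖f x‖
        · rw [hfs, indicator_of_notMem (by simpa using hx), norm_zero]
          exact hl.le
        · rw [hfs, indicator_of_mem (show x ∈ {x | l < ‖f x‖}ᶜ from hx)]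
          exact not_lt.1 hx
      have hfb2 : MemLp fb 2 := memLp_two_indicator_lt_norm hp hl hfm hf
      have hfst : MemLp fs ⊤ :=
        memLp_top_of_bound hfsm.aestronglyMeasurable l (Eventually.of_forall hfsl)
      refine ⟨squareFn j fb, (measurable_squareFn j hfbm).aemeasurable, ?_, fun x => ?_⟩
      · refine (lintegral_squareFn_sq_le j hfbm hfb2).trans_eq ?_
        rw [← lintegral_indicator hset]
        congr 1
        refine lintegral_congr fun x => ?_
        by_cases hx : l < ‖f x‖
        · rw [hfb, indicator_of_mem (show x ∈ {x | l < ‖f x‖} from hx),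
            indicator_of_mem (show x ∈ {x | l < ‖f x‖} from hx)]
        · rw [hfb, indicator_of_notMem (show x ∉ {x | l < ‖f x‖} from hx),
            indicator_of_notMem (show x ∉ {x | l < ‖f x‖} from hx)]
          simp
      · have hsum : f = fb + fs := (indicator_self_add_compl _ f).symm
        calc squareFn j f x = squareFn j (fb + fs) x := by rw [← hsum]
          _ ≤ squareFn j fb x + squareFn j fs x :=
            squareFn_add_le j one_le_two le_top hfb2 hfst hfbm hfsm x
          _ ≤ _ := by
            gcongr
            exact hbound j fs l x hfsm hl.le hfsl
    refine (ENNReal.rpow_le_rpow hmain (by positivity : 0 ≤ 1 / p)).trans ?_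
    rw [ENNReal.mul_rpow_of_nonneg _ _ (by positivity)]
    refine mul_le_mul_left ?_ _
    rw [← ENNReal.ofReal_mul (by positivity), ENNReal.ofReal_rpow_of_nonneg (by positivity)
      (by positivity)]
    refine ENNReal.ofReal_le_ofReal ?_
    have h1 : 4 * p / (p - 2) * (2 * (C * N ^ (d / 2 + η : ℝ))) ^ (p - 2) * (2 * N) =
        c * N ^ ((d / 2 + η) * (p - 2) + 1 : ℝ) := by
      rw [← mul_assoc 2 C, Real.mul_rpow (by positivity) (by positivity), ← Real.rpow_mul hN0.le,
        Real.rpow_add_one hN0.ne', hc]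
      ring
    rw [h1, Real.mul_rpow hc0.le (by positivity), ← Real.rpow_mul hN0.le]
    gcongr
    -- Interpolation yields a loss slightly smaller than `η`; the surplus `2η / p` is discarded.
    have h2 : ((d : ℝ) / 2 + η) * (p - 2) * (1 / p) + 1 * (1 / p) =
        d / 2 - (d - 1) / p + η - 2 * η / p := by
      field_simp
      ring
    rw [add_mul, h2]
    have : 0 ≤ 2 * η / p := by positivity
    linarith

end SquareFunctionLp

/-! ### The Bochner-Riesz multiplier as a superposition of Gaussians. -/

section Inversion

open Filter Topology Set

/-- The function `v₊ ^ δ e ^ {-v}` on the line. -/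
noncomputable def gammaFn (δ v : ℝ) : ℂ := ((max v 0) ^ δ * Real.exp (-v) : ℝ)

lemma gammaFn_of_nonpos {δ v : ℝ} (hδ : 0 < δ) (hv : v ≤ 0) : gammaFn δ v = 0 := by
  simp [gammaFn, max_eq_right hv, Real.zero_rpow hδ.ne']

lemma continuous_gammaFn {δ : ℝ} (hδ : 0 < δ) : Continuous (gammaFn δ) := by
  unfold gammaFn
  refine Complex.continuous_ofReal.comp (Continuous.mul ?_ (by fun_prop))
  exact (by fun_prop : Continuous fun v : ℝ => max v 0).rpow_const fun v => Or.inr hδ.le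

lemma integrable_gammaFn {δ : ℝ} (hδ : 0 < δ) : Integrable (gammaFn δ) := by
  have h1 : IntegrableOn (gammaFn δ) (Ioi 0) := by
    have h2 := (Real.GammaIntegral_convergent (by linarith : 0 < δ + 1)).ofReal (𝕜 := ℂ)
    refine IntegrableOn.congr_fun h2 (fun v (hv : 0 < v) => ?_) measurableSet_Ioi
    simp [gammaFn, max_eq_left hv.le, mul_comm]
  exact h1.integrable_of_forall_notMem_eq_zero fun v hv =>
    gammaFn_of_nonpos hδ (not_lt.1 hv)

lemma smul_gammaFn {δ : ℝ} (hδ : 0 < δ) (v : ℝ) : v • gammaFn δ v = gammaFn (δ + 1) v := by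
  rcases le_or_gt v 0 with hv | hv
  · rw [gammaFn_of_nonpos hδ hv, gammaFn_of_nonpos (by linarith) hv, smul_zero]
  · rw [gammaFn, gammaFn, max_eq_left hv.le, Real.rpow_add_one hv.ne', Complex.real_smul]
    push_cast
    ring

lemma hasDerivAt_max_rpow {δ : ℝ} (hδ : 0 < δ) (v : ℝ) :
    HasDerivAt (fun v : ℝ => (max v 0) ^ (δ + 1)) ((δ + 1) * (max v 0) ^ δ) v := by
  rcases lt_trichotomy v 0 with hv | rfl | hv
  · rw [max_eq_right hv.le, Real.zero_rpow hδ.ne', mul_zero]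
    refine (hasDerivAt_const v (0 : ℝ)).congr_of_eventuallyEq ?_
    filter_upwards [Iio_mem_nhds hv] with w (hw : w < 0)
    rw [max_eq_right hw.le, Real.zero_rpow (by linarith)]
  -- At the origin the exponent `δ + 1 > 1` makes both one-sided derivatives vanish.
  · rw [← hasDerivWithinAt_univ, ← Iic_union_Ici (a := (0 : ℝ))]
    have h0 : (δ + 1) * (max (0 : ℝ) 0) ^ δ = 0 := by
      rw [max_self, Real.zero_rpow hδ.ne', mul_zero]
    rw [h0]
    refine HasDerivWithinAt.union ?_ ?_
    · refine (hasDerivWithinAt_const (0 : ℝ) _ (0 : ℝ)).congr (fun w hw => ?_) ?_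
      · rw [max_eq_right hw, Real.zero_rpow (by linarith)]
      · rw [max_self, Real.zero_rpow (by linarith)]
    · have h1 := (Real.hasDerivAt_rpow_const (x := 0) (p := δ + 1)
        (Or.inr (by linarith))).hasDerivWithinAt (s := Ici 0)
      rw [add_sub_cancel_right, Real.zero_rpow hδ.ne', mul_zero] at h1
      exact h1.congr (fun w hw => by rw [max_eq_left hw]) (by rw [max_self])
  · rw [max_eq_left hv.le]
    have h1 := Real.hasDerivAt_rpow_const (x := v) (p := δ + 1) (Or.inl hv.ne')
    rw [add_sub_cancel_right] at h1
    refine h1.congr_of_eventuallyEq ?_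
    filter_upwards [Ioi_mem_nhds hv] with w (hw : 0 < w)
    rw [max_eq_left hw.le]

lemma hasDerivAt_gammaFn {δ : ℝ} (hδ : 0 < δ) (v : ℝ) :
    HasDerivAt (gammaFn (δ + 1)) ((δ + 1 : ℂ) * gammaFn δ v - gammaFn (δ + 1) v) v := by
  have h1 := ((hasDerivAt_max_rpow hδ v).mul (hasDerivAt_neg v).exp).ofReal_comp
  refine h1.congr_deriv ?_
  simp only [gammaFn]
  push_cast
  ring

/-- Transforming the derivative of `gammaFn (δ + 1)` gives `2πit` on one side and a term `-1` on the
other; together they form `b = 1 + 2πit`. -/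
lemma vertLine_mul_fourier_gammaFn {δ : ℝ} (hδ : 0 < δ) (t : ℝ) :
    vertLine t * 𝓕 (gammaFn (δ + 1)) t = (δ + 1) * 𝓕 (gammaFn δ) t := by
  have hd : deriv (gammaFn (δ + 1)) = (δ + 1 : ℂ) • gammaFn δ - gammaFn (δ + 1) := by
    ext v
    rw [(hasDerivAt_gammaFn hδ v).deriv]
    rfl
  have hi := (integrable_gammaFn hδ).smul (δ + 1 : ℂ)
  have hi1 := integrable_gammaFn (by linarith : 0 < δ + 1)
  have h1 := congrFun (Real.fourier_deriv hi1
    (fun v => (hasDerivAt_gammaFn hδ v).differentiableAt) (by rw [hd]; exact hi.sub hi1)) t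
  rw [hd] at h1
  have h2 : 𝓕 ((δ + 1 : ℂ) • gammaFn δ - gammaFn (δ + 1)) t =
      (δ + 1) * 𝓕 (gammaFn δ) t - 𝓕 (gammaFn (δ + 1)) t := by
    simp only [Real.fourier_eq, Pi.sub_apply, Pi.smul_apply, smul_sub]
    rw [integral_sub, ← integral_const_mul]
    · congr 1
      refine integral_congr_ae (Eventually.of_forall fun v => ?_)
      simp only [Circle.smul_def, smul_eq_mul]
      ring
    · exact (Real.fourierIntegral_convergent_iff t).2 hi
    · exact (Real.fourierIntegral_convergent_iff t).2 hi1
  rw [h2, smul_eq_mul] at h1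
  rw [vertLine]
  linear_combination -h1

lemma hasDerivAt_fourier_gammaFn {δ : ℝ} (hδ : 0 < δ) (t : ℝ) :
    HasDerivAt (𝓕 (gammaFn δ))
      (-(2 * Real.pi * Complex.I) * (δ + 1) / vertLine t * 𝓕 (gammaFn δ) t) t := by
  have hi1 := integrable_gammaFn (by linarith : 0 < δ + 1)
  have h1 := Real.hasDerivAt_fourier (integrable_gammaFn hδ)
    (by simpa only [smul_gammaFn hδ] using hi1) t
  refine h1.congr_deriv ?_
  have h2 : 𝓕 (fun x : ℝ => (-2 * Real.pi * Complex.I * x) • gammaFn δ x) t =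
      -(2 * Real.pi * Complex.I) * 𝓕 (gammaFn (δ + 1)) t := by
    simp only [Real.fourier_eq]
    rw [← integral_const_mul]
    refine integral_congr_ae (Eventually.of_forall fun v => ?_)
    simp only [← smul_gammaFn hδ, Circle.smul_def, smul_eq_mul, Complex.real_smul]
    ring
  rw [h2]
  have h3 := vertLine_mul_fourier_gammaFn hδ t
  field_simp [vertLine_ne_zero t]
  linear_combination -h3

/-- The transform solves a first-order linear equation whose solutions are multiples of `b ^ (-(δ +
1))`. The constant, a Gamma value, is left as the transform at `0` since only its finiteness
matters. -/
theorem fourier_gammaFn {δ : ℝ} (hδ : 0 < δ) (t : ℝ) :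
    𝓕 (gammaFn δ) t = 𝓕 (gammaFn δ) 0 * vertLine t ^ ((-(δ + 1) : ℝ) : ℂ) := by
  have hb : ∀ t, HasDerivAt vertLine (2 * Real.pi * Complex.I) t := fun t => by
    have := (((hasDerivAt_id (t : ℂ)).const_mul (2 * Real.pi : ℂ)).mul_const
      Complex.I).const_add 1
    exact this.comp_ofReal.congr_deriv (by simp)
  have hslit : ∀ t, vertLine t ∈ Complex.slitPlane := fun t => Or.inl (vertLine_re_pos t)
  have hd : ∀ t, HasDerivAt (fun t => 𝓕 (gammaFn δ) t * vertLine t ^ ((δ + 1 : ℝ) : ℂ)) 0 t := by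
    intro t
    have h1 := (hasDerivAt_fourier_gammaFn hδ t).mul
      ((hasDerivAt_id (vertLine t)).cpow_const (c := ((δ + 1 : ℝ) : ℂ)) (hslit t) |>.comp t (hb t))
    refine h1.congr_deriv ?_
    simp only [id, Function.comp]
    rw [Complex.cpow_sub _ _ (vertLine_ne_zero t), Complex.cpow_one]
    field_simp [vertLine_ne_zero t]
    push_cast
    ring
  have hc := is_const_of_deriv_eq_zero (fun t => (hd t).differentiableAt)
    (fun t => (hd t).deriv) t 0
  have h0 : vertLine 0 = 1 := by simp [vertLine]
  rw [h0, Complex.one_cpow, mul_one] at hc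
  rw [← hc, mul_assoc, ← Complex.cpow_add _ _ (vertLine_ne_zero t)]
  simp

/-- The density of the representation of `(1 - s)₊ ^ δ` as a superposition of the exponentials
`exp (-b s)`, `Re b = 1`. -/
noncomputable def lineDensity (δ t : ℝ) : ℂ :=
  Real.exp 1 * 𝓕 (gammaFn δ) t * Complex.exp (2 * Real.pi * t * Complex.I)

lemma norm_lineDensity {δ : ℝ} (hδ : 0 < δ) (t : ℝ) :
    ‖lineDensity δ t‖ = Real.exp 1 * ‖𝓕 (gammaFn δ) 0‖ * ‖vertLine t‖ ^ (-(δ + 1)) := by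
  rw [lineDensity, norm_mul, norm_mul, fourier_gammaFn hδ, norm_mul, Complex.norm_cpow_real,
    Complex.norm_of_nonneg (Real.exp_pos 1).le,
    show (2 * Real.pi * t * Complex.I : ℂ) = ((2 * Real.pi * t : ℝ) : ℂ) * Complex.I by
      push_cast; rfl, Complex.norm_exp_ofReal_mul_I]
  ring

lemma continuous_lineDensity {δ : ℝ} (hδ : 0 < δ) : Continuous (lineDensity δ) := by
  have h1 : Continuous (𝓕 (gammaFn δ)) :=
    continuous_iff_continuousAt.2 fun t => (hasDerivAt_fourier_gammaFn hδ t).continuousAt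
  unfold lineDensity
  fun_prop

lemma integrable_norm_vertLine_rpow {δ : ℝ} (hδ : 0 < δ) :
    Integrable fun t => ‖vertLine t‖ ^ (-(δ + 1)) := by
  have h1 := (integrable_rpow_neg_one_add_norm_sq (E := ℝ) (μ := volume) (r := δ + 1)
    (by simpa using hδ)).comp_mul_left' (R := 2 * Real.pi) (by positivity)
  refine h1.congr (Eventually.of_forall fun t => ?_)
  simp only [Real.norm_eq_abs, sq_abs]
  rw [← norm_vertLine_sq, ← Real.rpow_natCast, ← Real.rpow_mul (norm_nonneg _)]
  congr 1
  push_cast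
  ring

lemma integrable_lineDensity {δ : ℝ} (hδ : 0 < δ) : Integrable (lineDensity δ) := by
  refine Integrable.mono' ((integrable_norm_vertLine_rpow hδ).const_mul
    (Real.exp 1 * ‖𝓕 (gammaFn δ) 0‖)) (continuous_lineDensity hδ).aestronglyMeasurable ?_
  exact Eventually.of_forall fun t => (norm_lineDensity hδ t).le

/-- Fourier inversion of `gammaFn δ` at `1 - s`, multiplied by `exp (1 - s)`. The factor `exp b` in
the density comes from the shift by one. -/
lemma integral_lineDensity_mul_exp {δ : ℝ} (hδ : 0 < δ) (s : ℝ) :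
    ∫ t, lineDensity δ t * Complex.exp (-vertLine t * s) = ((max (1 - s) 0) ^ δ : ℝ) := by
  have hF : Integrable (𝓕 (gammaFn δ)) := by
    have h1 : Continuous (𝓕 (gammaFn δ)) :=
      continuous_iff_continuousAt.2 fun t => (hasDerivAt_fourier_gammaFn hδ t).continuousAt
    refine Integrable.mono' ((integrable_norm_vertLine_rpow hδ).const_mul
      ‖𝓕 (gammaFn δ) 0‖) h1.aestronglyMeasurable (Eventually.of_forall fun t => ?_)
    rw [fourier_gammaFn hδ t, norm_mul, Complex.norm_cpow_real]
  have h1 := congrFun ((continuous_gammaFn hδ).fourierInv_fourier_eq (integrable_gammaFn hδ) hF)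
    (1 - s)
  rw [Real.fourierInv_eq'] at h1
  have h2 : ((max (1 - s) 0) ^ δ : ℝ) = (Real.exp (1 - s) : ℂ) * gammaFn δ (1 - s) := by
    rw [gammaFn]
    push_cast
    rw [mul_left_comm, ← Complex.exp_add]
    simp
  rw [h2, ← h1, ← integral_const_mul]
  refine integral_congr_ae (Eventually.of_forall fun t => ?_)
  simp only [lineDensity, smul_eq_mul, RCLike.inner_apply, conj_trivial, vertLine]
  push_cast
  have h3 : Complex.exp (-(1 + 2 * Real.pi * t * Complex.I) * s) *
      (Complex.exp 1 * Complex.exp (2 * Real.pi * t * Complex.I)) =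
      Complex.exp (1 - s) * Complex.exp (2 * Real.pi * ((1 - s) * t) * Complex.I) := by
    rw [← Complex.exp_add, ← Complex.exp_add, ← Complex.exp_add]
    congr 1
    ring
  linear_combination 𝓕 (gammaFn δ) t * h3

/-- The bilinear superposition of the Gaussian multipliers over the line `Re b = 1`. -/
noncomputable def lineBilin {V : Type*} [NormedAddCommGroup V] [InnerProductSpace ℝ V]
    [FiniteDimensional ℝ V] [MeasurableSpace V] [BorelSpace V] (δ : ℝ) (f g : V → ℂ) (x : V) : ℂ :=
  ∫ t, lineDensity δ t * (heatOp (vertLine t) f x * heatOp (vertLine t) g x)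

/-- Fubini, justified by the integrable density, the bound one on the Gaussian multipliers, and the
integrability of the transforms of `f` and `g`. Positivity of `δ` makes the symbol vanish outside
the ball. -/
theorem bilinearBochnerRiesz_eq_lineBilin {n : ℕ} {δ : ℝ} (hδ : 0 < δ)
    (f g : 𝓢(EuclideanSpace ℝ (Fin n), ℂ)) (x : EuclideanSpace ℝ (Fin n)) :
    bilinearBochnerRiesz n δ f g x = lineBilin δ f g x := by
  set e : EuclideanSpace ℝ (Fin n) → ℂ := fun ξ => Complex.exp (2 * Real.pi * Complex.I * (inner ℝ x ξ : ℝ)) with he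
  have hen : ∀ ξ, ‖e ξ‖ = 1 := fun ξ => by
    rw [he]
    simp only
    rw [show (2 * Real.pi * Complex.I * (inner ℝ x ξ : ℝ) : ℂ) =
      ((2 * Real.pi * inner ℝ x ξ : ℝ) : ℂ) * Complex.I by push_cast; ring,
      Complex.norm_exp_ofReal_mul_I]
  have hec : Continuous e := by fun_prop
  set G : ℝ → EuclideanSpace ℝ (Fin n) × EuclideanSpace ℝ (Fin n) → ℂ :=
    fun t z => lineDensity δ t *
    ((e z.1 * gaussMul (vertLine t) z.1 * 𝓕 f z.1) *
      (e z.2 * gaussMul (vertLine t) z.2 * 𝓕 g z.2)) with hG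
  have hheat : ∀ (h : 𝓢(EuclideanSpace ℝ (Fin n), ℂ)) (t : ℝ), heatOp (vertLine t) h x =
      ∫ ξ, e ξ * gaussMul (vertLine t) ξ * 𝓕 h ξ := by
    intro h t
    rw [heatOp_schwartz_eq (vertLine_re_pos t), Real.fourierInv_eq']
    refine integral_congr_ae (Eventually.of_forall fun ξ => ?_)
    simp only [smul_eq_mul, he]
    rw [real_inner_comm]
    push_cast
    ring_nf
  have hright : lineBilin δ f g x = ∫ t, ∫ z, G t z := by
    refine integral_congr_ae (Eventually.of_forall fun t => ?_)
    simp only [hG]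
    rw [integral_const_mul, hheat, hheat, Measure.volume_eq_prod,
      integral_prod_mul (fun ξ => e ξ * gaussMul (vertLine t) ξ * 𝓕 f ξ)
        (fun ξ => e ξ * gaussMul (vertLine t) ξ * 𝓕 g ξ)]
  have hGint : Integrable (Function.uncurry G) (volume.prod volume) := by
    have hb : Integrable (fun q : ℝ × EuclideanSpace ℝ (Fin n) × EuclideanSpace ℝ (Fin n) =>
        lineDensity δ q.1 * (𝓕 f q.2.1 * 𝓕 g q.2.2))
        (volume.prod volume) := by
      refine (integrable_lineDensity hδ).mul_prod
        (g := fun z : EuclideanSpace ℝ (Fin n) × EuclideanSpace ℝ (Fin n) => 𝓕 f z.1 * 𝓕 g z.2) ?_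
      exact (𝓕 f).integrable.mul_prod (𝓕 g).integrable
    refine hb.mono ?_ (Eventually.of_forall fun q => ?_)
    · refine Continuous.aestronglyMeasurable ?_
      have h1 := continuous_lineDensity hδ
      have h2 := (𝓕 f).continuous
      have h3 := (𝓕 g).continuous
      simp only [hG, Function.uncurry_def, gaussMul]
      fun_prop
    · simp only [hG, Function.uncurry_def, norm_mul, hen, one_mul]
      have h1 := norm_gaussMul_le_one (vertLine_re_pos q.1) q.2.1
      have h2 := norm_gaussMul_le_one (vertLine_re_pos q.1) q.2.2
      gcongr
      · exact mul_le_of_le_one_left (norm_nonneg _) h1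
      · exact mul_le_of_le_one_left (norm_nonneg _) h2
  rw [hright, integral_integral_swap hGint, bilinearBochnerRiesz,
    ← integral_indicator (measurableSet_le (by fun_prop) (by fun_prop))]
  refine integral_congr_ae (Eventually.of_forall fun z => ?_)
  simp only
  have hval : ∫ t, G t z = ((max (1 - (‖z.1‖ ^ 2 + ‖z.2‖ ^ 2)) 0) ^ δ : ℝ) *
      (e z.1 * 𝓕 f z.1 * (e z.2 * 𝓕 g z.2)) := by
    rw [← integral_lineDensity_mul_exp hδ, ← integral_mul_const]
    refine integral_congr_ae (Eventually.of_forall fun t => ?_)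
    simp only [hG, gaussMul]
    push_cast
    rw [mul_add, Complex.exp_add]
    ring
  rw [hval]
  by_cases hz : ‖z.1‖ ^ 2 + ‖z.2‖ ^ 2 ≤ 1
  · rw [indicator_of_mem (by exact hz), max_eq_left (by linarith), inner_add_right,
      show 1 - (‖z.1‖ ^ 2 + ‖z.2‖ ^ 2) = 1 - ‖z.1‖ ^ 2 - ‖z.2‖ ^ 2 by ring]
    simp only [he]
    push_cast
    rw [mul_add, Complex.exp_add]
    ring
  · rw [indicator_of_notMem (by exact hz), max_eq_right (by linarith), Real.zero_rpow hδ.ne']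
    simp

end Inversion

/-! ### Summation over the dyadic blocks and the bilinear operator. -/

section Bilinear

open Filter Topology Set

/-- Minkowski's inequality for countable sums. -/
lemma lintegral_tsum_rpow_le {α : Type*} [MeasurableSpace α] {μ : Measure α} {u : ℕ → α → ℝ≥0∞}
    (hu : ∀ j, Measurable (u j)) {r : ℝ} (hr : 1 ≤ r) :
    (∫⁻ x, (∑' j, u j x) ^ r ∂μ) ^ (1 / r) ≤ ∑' j, (∫⁻ x, u j x ^ r ∂μ) ^ (1 / r) := by
  have hr0 : 0 < r := by linarith
  have hfin : ∀ N, (∫⁻ x, (∑ j ∈ Finset.range N, u j x) ^ r ∂μ) ^ (1 / r) ≤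
      ∑ j ∈ Finset.range N, (∫⁻ x, u j x ^ r ∂μ) ^ (1 / r) := by
    intro N
    induction N with
    | zero => simp [ENNReal.zero_rpow_of_pos hr0, hr0]
    | succ N ih =>
      simp only [Finset.sum_range_succ]
      refine (ENNReal.lintegral_Lp_add_le (f := fun x => ∑ j ∈ Finset.range N, u j x)
        (Finset.measurable_fun_sum _ fun j _ => hu j).aemeasurable
        (hu N).aemeasurable hr).trans ?_
      gcongr
  have hmono : Monotone fun N x => (∑ j ∈ Finset.range N, u j x) ^ r := by
    intro N M hNM x
    exact ENNReal.rpow_le_rpow (Finset.sum_le_sum_of_subset (Finset.range_mono hNM)) hr0.le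
  have hlim : ∫⁻ x, (∑' j, u j x) ^ r ∂μ =
      ⨆ N, ∫⁻ x, (∑ j ∈ Finset.range N, u j x) ^ r ∂μ := by
    rw [← lintegral_iSup (fun N => (Finset.measurable_fun_sum _ fun j _ => hu j).pow_const r) hmono]
    refine lintegral_congr fun x => ?_
    rw [ENNReal.tsum_eq_iSup_nat]
    exact (ENNReal.orderIsoRpow r hr0).map_iSup _
  rw [hlim]
  have hsup : (⨆ N, ∫⁻ x, (∑ j ∈ Finset.range N, u j x) ^ r ∂μ) ^ (1 / r) =
      ⨆ N, (∫⁻ x, (∑ j ∈ Finset.range N, u j x) ^ r ∂μ) ^ (1 / r) :=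
    (ENNReal.orderIsoRpow (1 / r) (by positivity)).map_iSup _
  rw [hsup]
  exact iSup_le fun N => (hfin N).trans (ENNReal.sum_le_tsum _)

variable {V : Type*} [NormedAddCommGroup V] [InnerProductSpace ℝ V] [FiniteDimensional ℝ V]
  [MeasurableSpace V] [BorelSpace V]

/-- The integral of the absolute values in the definition of `lineBilin`. -/
noncomputable def lineBilinAbs (δ : ℝ) (f g : V → ℂ) (x : V) : ℝ≥0∞ :=
  ∫⁻ t, ‖lineDensity δ t * (heatOp (vertLine t) f x * heatOp (vertLine t) g x)‖ₑ

lemma enorm_lineBilin_le (δ : ℝ) (f g : V → ℂ) (x : V) :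
    ‖lineBilin δ f g x‖ₑ ≤ lineBilinAbs δ f g x :=
  enorm_integral_le_lintegral_enorm _

lemma measurable_lineBilin_integrand {δ : ℝ} (hδ : 0 < δ) {f g : V → ℂ} (hf : Measurable f)
    (hg : Measurable g) : Measurable fun q : V × ℝ =>
      lineDensity δ q.2 * (heatOp (vertLine q.2) f q.1 * heatOp (vertLine q.2) g q.1) :=
  ((continuous_lineDensity hδ).measurable.comp measurable_snd).mul
    ((measurable_heatOp_vertLine hf).mul (measurable_heatOp_vertLine hg))

lemma measurable_lineBilinAbs {δ : ℝ} (hδ : 0 < δ) {f g : V → ℂ} (hf : Measurable f)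
    (hg : Measurable g) : Measurable (lineBilinAbs δ f g) :=
  (measurable_lineBilin_integrand hδ hf hg).enorm.lintegral_prod_right'

lemma stronglyMeasurable_lineBilin {δ : ℝ} (hδ : 0 < δ) {f g : V → ℂ} (hf : Measurable f)
    (hg : Measurable g) : StronglyMeasurable (lineBilin δ f g) :=
  (measurable_lineBilin_integrand hδ hf hg).stronglyMeasurable.integral_prod_right'
    (ν := volume)

/-- On each block the density is largest where `‖b‖` is smallest, and Cauchy-Schwarz in `t`
separates `f` from `g`. -/
lemma exists_lineBilinAbs_le {δ : ℝ} (hδ : 0 < δ) : ∃ c : ℝ, 0 ≤ c ∧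
    ∀ (f g : V → ℂ) (x : V), Measurable f → Measurable g →
      lineBilinAbs δ f g x ≤ ∑' j : ℕ, ENNReal.ofReal (c * (2 ^ j : ℝ) ^ (-(δ + 1))) *
        (squareFn j f x * squareFn j g x) := by
  refine ⟨Real.exp 1 * ‖𝓕 (gammaFn δ) 0‖, by positivity, fun f g x hf hg => ?_⟩
  have hm : ∀ {h : V → ℂ}, Measurable h → Measurable fun t => heatOp (vertLine t) h x := fun hh =>
    measurable_heatOp measurable_vertLine measurable_const hh
  rw [lineBilinAbs, ← setLIntegral_univ, ← iUnion_dyadicBlock]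
  refine (lintegral_iUnion_le _ _).trans (ENNReal.tsum_le_tsum fun j => ?_)
  calc _ ≤ ∫⁻ t in dyadicBlock j, ENNReal.ofReal
        (Real.exp 1 * ‖𝓕 (gammaFn δ) 0‖ * (2 ^ j : ℝ) ^ (-(δ + 1))) *
          (‖heatOp (vertLine t) f x‖ₑ * ‖heatOp (vertLine t) g x‖ₑ) := by
        refine setLIntegral_mono' (measurableSet_dyadicBlock j) fun t ht => ?_
        rw [enorm_mul, enorm_mul, ← ofReal_norm (lineDensity δ t), norm_lineDensity hδ]
        gcongr ENNReal.ofReal (_ * ?_) * _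
        exact Real.rpow_le_rpow_of_nonpos (by positivity) ht.1 (by linarith)
    _ ≤ _ := by
        rw [lintegral_const_mul' _ _ ENNReal.ofReal_ne_top]
        gcongr
        have := ENNReal.lintegral_mul_le_Lp_mul_Lq (volume.restrict (dyadicBlock j))
          Real.HolderConjugate.two_two (hm hf).enorm.aemeasurable (hm hg).enorm.aemeasurable
        simpa only [ENNReal.rpow_two] using! this

variable (V) in
theorem exists_lintegral_lineBilinAbs_rpow_le [Nontrivial V] {p q r δ : ℝ} (hp : 2 ≤ p)
    (hq : 2 ≤ q) (hr : 1 ≤ r) (hpqr : 1 / r = 1 / p + 1 / q)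
    (hδ : (Module.finrank ℝ V - 1 : ℝ) * (1 - 1 / r) < δ) :
    ∃ C : ℝ, 0 ≤ C ∧ ∀ f g : V → ℂ, Measurable f → Measurable g → MemLp f (ENNReal.ofReal p) →
      MemLp g (ENNReal.ofReal q) →
      (∫⁻ x, lineBilinAbs δ f g x ^ r) ^ (1 / r) ≤ ENNReal.ofReal C *
        ((∫⁻ x, ‖f x‖ₑ ^ p) ^ (1 / p) * (∫⁻ x, ‖g x‖ₑ ^ q) ^ (1 / q)) := by
  set d := Module.finrank ℝ V with hd
  have hd1 : (1 : ℝ) ≤ d := by exact_mod_cast (Module.finrank_pos : 0 < Module.finrank ℝ V)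
  have hr0 : 0 < r := by linarith
  have hδ0 : 0 < δ := by
    have h1 : 1 / r ≤ 1 := by rw [div_le_one hr0]; exact hr
    exact (mul_nonneg (sub_nonneg.2 hd1) (sub_nonneg.2 h1)).trans_lt hδ
  -- A quarter of the available gap: the two square functions lose `2η` in total, leaving the ratio
  -- `2 ^ (-2η)` for a geometric series.
  set η : ℝ := (δ - (d - 1 : ℝ) * (1 - 1 / r)) / 4 with hη
  have hη0 : 0 < η := by
    rw [hη]
    linarith
  obtain ⟨c, hc, hpt⟩ := exists_lineBilinAbs_le (V := V) hδ0
  obtain ⟨A, hA, hfA⟩ := exists_lintegral_squareFn_rpow_le V hp hη0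
  obtain ⟨B, hB, hgB⟩ := exists_lintegral_squareFn_rpow_le V hq hη0
  have hgeo0 : (0 : ℝ) ≤ 2 ^ (-(2 * η)) := by positivity
  have hgeo1 : (2 : ℝ) ^ (-(2 * η)) < 1 :=
    Real.rpow_lt_one_of_one_lt_of_neg one_lt_two (by linarith)
  refine ⟨c * A * B * (1 - 2 ^ (-(2 * η)))⁻¹,
    mul_nonneg (by positivity) (inv_nonneg.2 (sub_nonneg.2 hgeo1.le)),
    fun f g hf hg hfp hgq => ?_⟩
  set X := (∫⁻ x, ‖f x‖ₑ ^ p) ^ (1 / p) * (∫⁻ x, ‖g x‖ₑ ^ q) ^ (1 / q) with hX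
  have hterm : ∀ j : ℕ, (∫⁻ x, (ENNReal.ofReal (c * (2 ^ j : ℝ) ^ (-(δ + 1))) *
      (squareFn j f x * squareFn j g x)) ^ r) ^ (1 / r) ≤
      ENNReal.ofReal (c * A * B * (2 ^ (-(2 * η))) ^ j) * X := by
    intro j
    set N : ℝ := 2 ^ j with hN
    have hN0 : 0 < N := by positivity
    set κ := ENNReal.ofReal (c * N ^ (-(δ + 1))) with hκ
    calc _ = κ * (∫⁻ x, (squareFn j f x * squareFn j g x) ^ r) ^ (1 / r) := by
          simp_rw [ENNReal.mul_rpow_of_nonneg κ _ hr0.le]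
          rw [lintegral_const_mul' _ _ (ENNReal.rpow_ne_top_of_nonneg hr0.le ENNReal.ofReal_ne_top),
            ENNReal.mul_rpow_of_nonneg _ _ (by positivity), ← ENNReal.rpow_mul,
            mul_one_div_cancel hr0.ne', ENNReal.rpow_one]
      _ ≤ κ * ((∫⁻ x, squareFn j f x ^ p) ^ (1 / p) * (∫⁻ x, squareFn j g x ^ q) ^ (1 / q)) := by
          gcongr
          refine ENNReal.lintegral_Lp_mul_le_Lq_mul_Lr hr0 ?_ hpqr volume
            (measurable_squareFn j hf).aemeasurable (measurable_squareFn j hg).aemeasurable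
          have h1 : 0 < 1 / q := by positivity
          have h2 : 1 / p < 1 / r := by linarith
          exact lt_of_one_div_lt_one_div (by linarith) h2
      _ ≤ κ * ((ENNReal.ofReal (A * N ^ (d / 2 - (d - 1) / p + η : ℝ)) *
            (∫⁻ x, ‖f x‖ₑ ^ p) ^ (1 / p)) * (ENNReal.ofReal (B * N ^ (d / 2 - (d - 1) / q + η : ℝ)) *
            (∫⁻ x, ‖g x‖ₑ ^ q) ^ (1 / q))) := by
          gcongr
          · exact hfA j f hf hfp
          · exact hgB j g hg hgq
      _ = ENNReal.ofReal (c * N ^ (-(δ + 1))) *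
            ENNReal.ofReal (A * N ^ (d / 2 - (d - 1) / p + η : ℝ)) *
            ENNReal.ofReal (B * N ^ (d / 2 - (d - 1) / q + η : ℝ)) * X := by
          rw [hX, hκ]
          ring
      _ = _ := by
          rw [← ENNReal.ofReal_mul (by positivity), ← ENNReal.ofReal_mul (by positivity)]
          congr 2
          have h1 : ((2 : ℝ) ^ (-(2 * η))) ^ j = N ^ (-(2 * η)) := by
            rw [hN, ← Real.rpow_natCast, ← Real.rpow_natCast, ← Real.rpow_mul (by norm_num),
              ← Real.rpow_mul (by norm_num), mul_comm]
          have h2 : -(2 * η) = -(δ + 1) + (d / 2 - (d - 1) / p + η) + (d / 2 - (d - 1) / q + η) := by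
            have h3 : ((d : ℝ) - 1) / p + (d - 1) / q = (d - 1) * (1 / r) := by
              rw [hpqr]
              ring
            have h4 : 4 * η = δ - (d - 1 : ℝ) * (1 - 1 / r) := by
              rw [hη]
              ring
            linarith
          rw [h1, h2, Real.rpow_add hN0 (-(δ + 1) + (d / 2 - (d - 1) / p + η)),
            Real.rpow_add hN0 (-(δ + 1))]
          ring
  calc (∫⁻ x, lineBilinAbs δ f g x ^ r) ^ (1 / r)
      ≤ (∫⁻ x, (∑' j : ℕ, ENNReal.ofReal (c * (2 ^ j : ℝ) ^ (-(δ + 1))) *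
          (squareFn j f x * squareFn j g x)) ^ r) ^ (1 / r) := by
        gcongr with x
        exact hpt f g x hf hg
    _ ≤ ∑' j : ℕ, ENNReal.ofReal (c * A * B * (2 ^ (-(2 * η))) ^ j) * X :=
        (lintegral_tsum_rpow_le (fun j => ((measurable_squareFn j hf).mul
          (measurable_squareFn j hg)).const_mul _) hr).trans (ENNReal.tsum_le_tsum hterm)
    _ = _ := by
        rw [ENNReal.tsum_mul_right, ← ENNReal.ofReal_tsum_of_nonneg (fun j => by positivity)
          ((summable_geometric_of_lt_one hgeo0 hgeo1).mul_left _), tsum_mul_left,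
          tsum_geometric_of_lt_one hgeo0 hgeo1]

lemma eLpNorm_ofReal_eq {p : ℝ} (hp : 0 < p) (f : V → ℂ) :
    eLpNorm f (ENNReal.ofReal p) volume = (∫⁻ x, ‖f x‖ₑ ^ p) ^ (1 / p) := by
  rw [eLpNorm_eq_lintegral_rpow_enorm_toReal (by simpa using hp) ENNReal.ofReal_ne_top,
    ENNReal.toReal_ofReal hp.le]

/-- The bilinear operator `lineBilin` is bounded from `L^p × L^q` to `L^r`. -/
theorem exists_bilinear_eq_lineBilin [Nontrivial V] {p q r δ : ℝ} (hp : 2 ≤ p)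
    (hq : 2 ≤ q) (hr : 1 ≤ r) (hpqr : 1 / r = 1 / p + 1 / q)
    (hδ0 : 0 < δ) (hδ : (Module.finrank ℝ V - 1 : ℝ) * (1 - 1 / r) < δ) :
    ∃ B : Lp ℂ (ENNReal.ofReal p) (volume : Measure V) →ₗ[ℂ]
        Lp ℂ (ENNReal.ofReal q) (volume : Measure V) →ₗ[ℂ]
        Lp ℂ (ENNReal.ofReal r) (volume : Measure V),
      (∃ C : ℝ, ∀ f g, ‖B f g‖ ≤ C * ‖f‖ * ‖g‖) ∧
      ∀ f g, (B f g : V → ℂ) =ᵐ[volume] lineBilin δ f g := by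
  have hp0 : 0 < p := by linarith
  have hq0 : 0 < q := by linarith
  have hr0 : 0 < r := by linarith
  have hp1 : 1 ≤ ENNReal.ofReal p := by
    rw [ENNReal.one_le_ofReal]
    linarith
  have hq1 : 1 ≤ ENNReal.ofReal q := by
    rw [ENNReal.one_le_ofReal]
    linarith
  obtain ⟨C, hC, hbound⟩ := exists_lintegral_lineBilinAbs_rpow_le V hp hq hr hpqr hδ
  have hmeas : ∀ {s : ℝ≥0∞} (f : Lp ℂ s (volume : Measure V)), Measurable f := fun f =>
    (Lp.stronglyMeasurable f).measurable
  have hfin : ∀ (f : Lp ℂ (ENNReal.ofReal p) (volume : Measure V))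
      (g : Lp ℂ (ENNReal.ofReal q) (volume : Measure V)),
      (∫⁻ x, lineBilinAbs δ f g x ^ r) ^ (1 / r) ≤ ENNReal.ofReal C * (‖f‖ₑ * ‖g‖ₑ) := by
    intro f g
    have := hbound f g (hmeas f) (hmeas g) (Lp.memLp f) (Lp.memLp g)
    rwa [← eLpNorm_ofReal_eq hp0, ← eLpNorm_ofReal_eq hq0, ← Lp.enorm_def, ← Lp.enorm_def] at this
  -- Additivity of the integral over `t` needs absolute convergence. The `L^r` bound provides it for
  -- almost every `x`, which is enough in `Lp`, so the operator is defined by its formula on all of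
  -- `L^p × L^q`, without extension by density.
  have hint : ∀ (f : Lp ℂ (ENNReal.ofReal p) (volume : Measure V))
      (g : Lp ℂ (ENNReal.ofReal q) (volume : Measure V)), ∀ᵐ x, Integrable fun t =>
        lineDensity δ t * (heatOp (vertLine t) f x * heatOp (vertLine t) g x) := by
    intro f g
    have h1 : (∫⁻ x, lineBilinAbs δ f g x ^ r) ^ (1 / r) ≠ ⊤ := by
      refine ne_top_of_le_ne_top ?_ (hfin f g)
      rw [Lp.enorm_def, Lp.enorm_def]
      exact ENNReal.mul_ne_top ENNReal.ofReal_ne_top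
        (ENNReal.mul_ne_top (Lp.memLp f).2.ne (Lp.memLp g).2.ne)
    have h2 : ∫⁻ x, lineBilinAbs δ f g x ^ r ≠ ⊤ := by
      intro h
      rw [h, ENNReal.top_rpow_of_pos (by positivity)] at h1
      exact h1 rfl
    have h3 := measurable_lineBilinAbs hδ0 (hmeas f) (hmeas g)
    filter_upwards [ae_lt_top (h3.pow_const r) h2] with x hx
    refine ⟨((measurable_lineBilin_integrand hδ0 (hmeas f) (hmeas g)).comp
      (measurable_const.prodMk measurable_id)).aestronglyMeasurable, ?_⟩
    by_contra hcon
    have h4 : lineBilinAbs δ f g x = ⊤ := not_lt_top_iff.1 hcon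
    rw [h4, ENNReal.top_rpow_of_pos hr0] at hx
    exact lt_irrefl _ hx
  have hle : ∀ (f : Lp ℂ (ENNReal.ofReal p) (volume : Measure V))
      (g : Lp ℂ (ENNReal.ofReal q) (volume : Measure V)),
      eLpNorm (lineBilin δ f g) (ENNReal.ofReal r) volume ≤
        ENNReal.ofReal C * (‖f‖ₑ * ‖g‖ₑ) := by
    intro f g
    rw [eLpNorm_ofReal_eq hr0]
    refine le_trans ?_ (hfin f g)
    gcongr with x
    exact enorm_lineBilin_le δ f g x
  have hmem : ∀ (f : Lp ℂ (ENNReal.ofReal p) (volume : Measure V))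
      (g : Lp ℂ (ENNReal.ofReal q) (volume : Measure V)),
      MemLp (lineBilin δ f g) (ENNReal.ofReal r) volume := by
    intro f g
    refine ⟨(stronglyMeasurable_lineBilin hδ0 (hmeas f) (hmeas g)).aestronglyMeasurable, ?_⟩
    refine (hle f g).trans_lt ?_
    rw [Lp.enorm_def, Lp.enorm_def]
    exact ENNReal.mul_lt_top ENNReal.ofReal_lt_top
      (ENNReal.mul_lt_top (Lp.memLp f).2 (Lp.memLp g).2)
  have hheat_add : ∀ {s : ℝ} (_ : 1 ≤ ENNReal.ofReal s)
      (f₁ f₂ : Lp ℂ (ENNReal.ofReal s) (volume : Measure V)) (t : ℝ) (x : V),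
      heatOp (vertLine t) (f₁ + f₂ : Lp ℂ (ENNReal.ofReal s) (volume : Measure V)) x =
        heatOp (vertLine t) f₁ x + heatOp (vertLine t) f₂ x := fun hs f₁ f₂ t x => by
    rw [heatOp_congr_ae _ (Lp.coeFn_add f₁ f₂),
      heatOp_add (vertLine_re_pos t) hs hs (Lp.memLp f₁) (Lp.memLp f₂)]
  have hheat_smul : ∀ {s : ℝ} (c : ℂ) (f : Lp ℂ (ENNReal.ofReal s) (volume : Measure V)) (t : ℝ)
      (x : V), heatOp (vertLine t) (c • f : Lp ℂ (ENNReal.ofReal s) (volume : Measure V)) x =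
        c * heatOp (vertLine t) f x := fun c f t x => by
    rw [heatOp_congr_ae _ (Lp.coeFn_smul c f), heatOp_smul]
  let B : Lp ℂ (ENNReal.ofReal p) (volume : Measure V) →ₗ[ℂ]
      Lp ℂ (ENNReal.ofReal q) (volume : Measure V) →ₗ[ℂ]
      Lp ℂ (ENNReal.ofReal r) (volume : Measure V) :=
    LinearMap.mk₂ ℂ (fun f g => (hmem f g).toLp _)
      (fun f₁ f₂ g => by
        rw [← MemLp.toLp_add, MemLp.toLp_eq_toLp_iff]
        filter_upwards [hint f₁ g, hint f₂ g] with x h₁ h₂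
        rw [Pi.add_apply]
        simp only [lineBilin]
        rw [← integral_add h₁ h₂]
        refine integral_congr_ae (Eventually.of_forall fun t => ?_)
        simp only [hheat_add hp1]
        ring)
      (fun c f g => by
        rw [← MemLp.toLp_const_smul, MemLp.toLp_eq_toLp_iff]
        refine Eventually.of_forall fun x => ?_
        rw [Pi.smul_apply, smul_eq_mul]
        simp only [lineBilin]
        rw [← integral_const_mul]
        refine integral_congr_ae (Eventually.of_forall fun t => ?_)
        simp only [hheat_smul]
        ring)
      (fun f g₁ g₂ => by
        rw [← MemLp.toLp_add, MemLp.toLp_eq_toLp_iff]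
        filter_upwards [hint f g₁, hint f g₂] with x h₁ h₂
        rw [Pi.add_apply]
        simp only [lineBilin]
        rw [← integral_add h₁ h₂]
        refine integral_congr_ae (Eventually.of_forall fun t => ?_)
        simp only [hheat_add hq1]
        ring)
      (fun c f g => by
        rw [← MemLp.toLp_const_smul, MemLp.toLp_eq_toLp_iff]
        refine Eventually.of_forall fun x => ?_
        rw [Pi.smul_apply, smul_eq_mul]
        simp only [lineBilin]
        rw [← integral_const_mul]
        refine integral_congr_ae (Eventually.of_forall fun t => ?_)
        simp only [hheat_smul]
        ring)
  have hB : ∀ f g, B f g = (hmem f g).toLp _ := fun f g => rfl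
  refine ⟨B, ⟨C, fun f g => ?_⟩, fun f g => ?_⟩
  · rw [hB, Lp.norm_toLp]
    have hnorm : ∀ {s : ℝ} (h : Lp ℂ (ENNReal.ofReal s) (volume : Measure V)),
        ‖h‖ₑ = ENNReal.ofReal ‖h‖ := fun h => by
      rw [Lp.norm_def, Lp.enorm_def, ENNReal.ofReal_toReal (Lp.memLp h).2.ne]
    have hnn : ∀ {s : ℝ} (h : Lp ℂ (ENNReal.ofReal s) (volume : Measure V)), 0 ≤ ‖h‖ :=
      fun h => by
        rw [Lp.norm_def]
        exact ENNReal.toReal_nonneg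
    refine ENNReal.toReal_le_of_le_ofReal (mul_nonneg (mul_nonneg hC (hnn f)) (hnn g))
      ((hle f g).trans_eq ?_)
    rw [hnorm, hnorm, mul_assoc, ENNReal.ofReal_mul hC, ENNReal.ofReal_mul (hnn f)]
  · rw [hB]
    exact (hmem f g).coeFn_toLp

lemma lineBilin_congr_ae (δ : ℝ) {f f' g g' : V → ℂ} (hf : f =ᵐ[volume] f')
    (hg : g =ᵐ[volume] g') : lineBilin δ f g = lineBilin δ f' g' := by
  ext x
  refine integral_congr_ae (Eventually.of_forall fun t => ?_)
  simp only
  rw [heatOp_congr_ae _ hf, heatOp_congr_ae _ hg]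

end Bilinear

/-! ### The theorem on `ℝⁿ`. -/

theorem mainTheorem11 (n : ℕ) (hn : 1 ≤ n) (p q r r' δ : ℝ)
    (hp : 2 ≤ p) (hq : 2 ≤ q) (hr' : 2 ≤ r')
    (hpqr : 1 / p + 1 / q + 1 / r' = 1) (hrr' : 1 / r + 1 / r' = 1)
    (hδ : ((n : ℝ) - 1) / r' < δ) :
    IsBoundedBilinear (bilinearBochnerRiesz n δ)
      (ENNReal.ofReal p) (ENNReal.ofReal q) (ENNReal.ofReal r) := by
  have hn' : (1 : ℝ) ≤ n := by exact_mod_cast hn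
  have hr'0 : 0 < 1 / r' := by positivity
  have hr'1 : 1 / r' ≤ 1 / 2 := one_div_le_one_div_of_le (by norm_num) hr'
  have hr0 : 0 < r := by
    rw [← one_div_pos]
    linarith
  have hr1 : 1 ≤ r := by
    have h1 : 1 / r ≤ 1 := by linarith
    rwa [div_le_one hr0] at h1
  have hδ0 : 0 < δ := (div_nonneg (sub_nonneg.2 hn') (by linarith)).trans_lt hδ
  -- Makes the Euclidean space nontrivial, as polar coordinates require.
  have : Nonempty (Fin n) := ⟨⟨0, hn⟩⟩
  obtain ⟨B, hB, hBeq⟩ := exists_bilinear_eq_lineBilin (V := EuclideanSpace ℝ (Fin n))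
    (p := p) (q := q) (r := r) (δ := δ) hp hq hr1 (by linarith) hδ0 (by
      rw [finrank_euclideanSpace_fin, show 1 - 1 / r = 1 / r' by linarith, mul_one_div]
      exact hδ)
  refine ⟨B, hB, fun f g => (hBeq _ _).trans ?_⟩
  have h1 : bilinearBochnerRiesz n δ f g = lineBilin δ f g :=
    funext (bilinearBochnerRiesz_eq_lineBilin hδ0 f g)
  rw [h1, lineBilin_congr_ae δ (f.coeFn_toLp _ volume) (g.coeFn_toLp _ volume)]
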